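/- Let $m\ge 1$ and let $\mathbb{R}_m$ be the real Clifford algebra generated by $e_1,\dots,e_m$ with $e_ie_j+e_je_i=-2\delta_{ij}$, with the norm $|\sum_A x_Ae_A|=(\sum_A x_A^2)^{1/2}$ in the basis of products $e_A=e_{i_1}\cdots e_{i_k}$, $A=\{i_1<\dots<i_k\}$. A point $x=(x_0,\dots,x_m)\in\mathbb{R}^{m+1}$ is identified with the paravector $x_0+\underline{x}$, $\underline{x}=\sum_{j=1}^m x_je_j$; put $\overline{x}=x_0-\underline{x}$. The real axis is $\mathbb{R}=\{\underline{x}=0\}$. Let $\mathbb{S}$ be the unit sphere $\{\underline{x}:|\underline{x}|=1\}$ and $\omega_{m-1}$ its surface area ($\omega_0=2$). For $D\subset\mathbb{C}$ open put $\Omega_D=\{u+Jv: u+iv\in D,\ J\in\mathbb{S}\}\subset\mathbb{R}^{m+1}$; an open set of this form is called axially symmetric. Let $$S^{-1}(q,x)=-(q^2-2x_0q+|x|^2)^{-1}(q-\overline{x}),\qquad K(q,x)=\frac{2\,S^{-1}(q,x)}{\omega_{m-1}|\underline{x}|^{m-1}},$$ $$T_{\Omega_D}f(q)=-\frac1{2\pi}\int_{\Omega_D}K(q,x)f(x)\,dV(x),\qquad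 G=\frac{\partial}{\partial x_0}+\frac{\underline{x}}{|\underline{x}|^2}\sum_{j=1}^m x_j\frac{\partial}{\partial x_j}.$$ Let $\Omega_D\subset\mathbb{R}^{m+1}\setminus\mathbb{R}$ be a bounded axially symmetric open set (not necessarily connected) and let $\max\{m,2\}<p<\infty$. Then: 1. For every $f\in L^p(\Omega_D;\mathbb{R}_m)$ the integral defining $T_{\Omega_D}f(q)$ exists (converges absolutely) for every $q\in\mathbb{R}^{m+1}$ that is not a real boundary point of $\Omega_D$, i.e. for every $q\in\mathbb{R}^{m+1}\setminus(\partial\Omega_D\cap\mathbb{R})$, in particular for every $q\in\mathbb{R}^{m+1}\setminus\mathbb{R}$; if moreover $p>m+1$ (which is automatic when $m=1$), it exists for every $q\in\mathbb{R}^{m+1}$. 2. For every such $f$, the function $T_{\Omega_D}f$ is differentiable and satisfies $G\,T_{\Omega_D}f=0$ at every point of $(\mathbb{R}^{m+1}\setminus\mathbb{R})\setminus\overline{\Omega_D}$. 3. There is a constant $C$, independent of $f$, such that for every $f\in L^p(\Omega_D;\mathbb{R}_m)$ one has $T_{\Omega_D}f\in L^p(\Omega_D;\mathbb{R}_m)$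 and $\|T_{\Omega_D}f\|_{L^p(\Omega_D)}\le C\,\|f\|_{L^p(\Omega_D)}$. -/

import Mathlib

open MeasureTheory
open scoped ENNReal NNReal

namespace SliceClifford

noncomputable section

/-! ### The real Clifford algebra with `e i * e j + e j * e i = -2 δ i j`, and its norm -/

/-- The quadratic form `x ↦ -(x₁² + ⋯ + x_m²)` on `ℝ^m`. -/
abbrev negSumSq (m : ℕ) : QuadraticForm ℝ (Fin m → ℝ) :=
  QuadraticMap.weightedSumSquares ℝ (fun _ : Fin m => (-1 : ℝ))

/-- The real Clifford algebra on `m` generators of square `-1`. -/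
abbrev Cl (m : ℕ) : Type := CliffordAlgebra (negSumSq m)

/-- The generators `e 1, …, e m` of the Clifford algebra. -/
def e {m : ℕ} (i : Fin m) : Cl m := CliffordAlgebra.ι (negSumSq m) (Pi.single i 1)

/-- For `A = {i₁ < ⋯ < i_k}`, the product `e i₁ * ⋯ * e i_k`. -/
def blade {m : ℕ} (A : Finset (Fin m)) : Cl m := ((A.sort (· ≤ ·)).map e).prod

theorem negSumSq_apply {m : ℕ} (v : Fin m → ℝ) : negSumSq m v = -∑ i, v i ^ 2 := by
  simp [negSumSq, QuadraticMap.weightedSumSquares_apply, sq]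

theorem e_mul_self {m : ℕ} (i : Fin m) : e i * e i = (-1 : Cl m) := by
  rw [e, CliffordAlgebra.ι_sq_scalar, negSumSq_apply, Finset.sum_eq_single i]
  · simp
  · intro j _ hj
    simp [hj]
  · simp

theorem polar_single {m : ℕ} {i j : Fin m} (h : i ≠ j) :
    QuadraticMap.polar (negSumSq m) (Pi.single i 1) (Pi.single j 1) = 0 := by
  simp only [QuadraticMap.polar, negSumSq_apply]
  have : ∀ k : Fin m, ((Pi.single i (1 : ℝ) + Pi.single j 1 : Fin m → ℝ) k) ^ 2 =
      (Pi.single i (1 : ℝ) : Fin m → ℝ) k ^ 2 + (Pi.single j (1 : ℝ) : Fin m → ℝ) k ^ 2 := by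
    intro k
    rcases eq_or_ne k i with rfl | hk
    · simp [Pi.single_eq_of_ne h]
    · simp [Pi.single_eq_of_ne hk]
  simp_rw [this, Finset.sum_add_distrib]
  ring

theorem e_mul_e_add_swap {m : ℕ} {i j : Fin m} (h : i ≠ j) :
    e i * e j + e j * e i = (0 : Cl m) := by
  rw [e, e, CliffordAlgebra.ι_mul_ι_add_swap, polar_single h, map_zero]

/-- The basis of the Clifford algebra indexed by the subsets of `{1, …, m}`; its members are the
products `blade A`, see `cliffordBasis_apply`. -/
def cliffordBasis (m : ℕ) : Module.Basis (Finset (Fin m)) ℝ (Cl m) :=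
  ((Pi.basisFun ℝ (Fin m)).ExteriorAlgebra).map
    (CliffordAlgebra.equivExterior (negSumSq m)).symm

theorem contractLeft_list_prod {V : Type*} [AddCommGroup V] [Module ℝ V]
    (Q : QuadraticForm ℝ V) (d : Module.Dual ℝ V) (l : List V) (h : ∀ v ∈ l, d v = 0) :
    CliffordAlgebra.contractLeft d ((l.map (CliffordAlgebra.ι Q)).prod) = 0 := by
  induction l with
  | nil => simp
  | cons a l ih =>
    rw [List.map_cons, List.prod_cons, CliffordAlgebra.contractLeft_ι_mul,
      ih (fun v hv => h v (List.mem_cons_of_mem _ hv)), h a (by simp)]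
    simp

theorem changeForm_list_prod {V : Type*} [AddCommGroup V] [Module ℝ V]
    {Q Q' : QuadraticForm ℝ V} {B : LinearMap.BilinForm ℝ V}
    (hB : LinearMap.BilinMap.toQuadraticMap B = Q' - Q) (l : List V)
    (h : l.Pairwise (fun v w => B v w = 0)) :
    CliffordAlgebra.changeForm hB ((l.map (CliffordAlgebra.ι Q)).prod) =
      (l.map (CliffordAlgebra.ι Q')).prod := by
  induction l with
  | nil => simp
  | cons a l ih =>
    rw [List.pairwise_cons] at h
    rw [List.map_cons, List.prod_cons, CliffordAlgebra.changeForm_ι_mul, ih h.2,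
      contractLeft_list_prod _ _ _ h.1, sub_zero, List.map_cons, List.prod_cons]

theorem cliffordBasis_apply {m : ℕ} (A : Finset (Fin m)) : cliffordBasis m A = blade A := by
  rw [cliffordBasis, Module.Basis.map_apply, LinearEquiv.symm_apply_eq,
    ExteriorAlgebra.basis_apply_ofCard (n := A.card) (Pi.basisFun ℝ (Fin m)) rfl,
    ExteriorAlgebra.ιMulti_family, ExteriorAlgebra.ιMulti_apply]
  have key : (blade A : Cl m) =
      (((A.sort (· ≤ ·)).map (fun i => (Pi.single i 1 : Fin m → ℝ))).map
        (CliffordAlgebra.ι (negSumSq m))).prod := by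
    rw [blade, List.map_map]; rfl
  rw [key, CliffordAlgebra.equivExterior, CliffordAlgebra.changeFormEquiv_apply,
    changeForm_list_prod]
  · rw [List.ofFn_eq_map, ← Finset.listMap_orderEmbOfFin_finRange A rfl]
    simp only [List.map_map]
    congr 1
    apply List.map_congr_left
    intro i _
    simp only [Function.comp_apply, Pi.basisFun_apply]
    rfl
  · rw [List.pairwise_map]
    refine (A.sort_nodup (· ≤ ·)).imp ?_
    intro i j hij
    have h2 := polar_single (m := m) hij
    rw [QuadraticMap.polar] at h2
    rw [QuadraticMap.associated_apply]
    simp only [neg_apply]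
    rw [show -(negSumSq m) (Pi.single i 1 + Pi.single j 1) - -(negSumSq m) (Pi.single i 1)
      - -(negSumSq m) (Pi.single j 1) = 0 by linarith]
    simp

/-- Coordinates with respect to the basis `blade A`, as a vector of Euclidean space. -/
def coords (m : ℕ) : Cl m ≃ₗ[ℝ] EuclideanSpace ℝ (Finset (Fin m)) :=
  (cliffordBasis m).equivFun.trans (WithLp.linearEquiv 2 ℝ (Finset (Fin m) → ℝ)).symm

/-- The norm `|∑ x_A e_A| = (∑ x_A²)^{1/2}`. -/
instance instNormedAddCommGroupCl (m : ℕ) : NormedAddCommGroup (Cl m) :=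
  NormedAddCommGroup.induced (Cl m) (EuclideanSpace ℝ (Finset (Fin m))) (coords m)
    (coords m).injective

theorem norm_eq_sqrt {m : ℕ} (x : Cl m) :
    ‖x‖ = Real.sqrt (∑ A, ((cliffordBasis m).repr x A) ^ 2) := by
  change ‖coords m x‖ = _
  rw [EuclideanSpace.norm_eq]
  simp [coords]

instance instNormedSpaceCl (m : ℕ) : NormedSpace ℝ (Cl m) :=
  NormedSpace.induced ℝ (Cl m) (EuclideanSpace ℝ (Finset (Fin m))) (coords m)

instance instFiniteDimensionalCl (m : ℕ) : FiniteDimensional ℝ (Cl m) :=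
  (cliffordBasis m).finiteDimensional_of_finite

instance instCompleteSpaceCl (m : ℕ) : CompleteSpace (Cl m) :=
  FiniteDimensional.complete ℝ (Cl m)

/-! ### Paravectors: points `x = (x₀, x₁, …, x_m)` of `ℝ^{m+1}` -/

/-- `ℝ^{m+1}` with the Euclidean norm. -/
abbrev Para (m : ℕ) : Type := EuclideanSpace ℝ (Fin (m + 1))

/-- The `1`-vector part `x₁ e₁ + ⋯ + x_m e_m` of a paravector. -/
def vec {m : ℕ} (x : Para m) : Cl m := ∑ j : Fin m, x j.succ • e j

/-- The length `(x₁² + ⋯ + x_m²)^{1/2}` of the `1`-vector part. -/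
def vecNorm {m : ℕ} (x : Para m) : ℝ := Real.sqrt (∑ j : Fin m, x j.succ ^ 2)

/-- The paravector `x₀ + x₁ e₁ + ⋯ + x_m e_m` as an element of the Clifford algebra. -/
def toCl {m : ℕ} (x : Para m) : Cl m := algebraMap ℝ (Cl m) (x 0) + vec x

/-- The Clifford conjugate `x₀ - (x₁ e₁ + ⋯ + x_m e_m)` of a paravector. -/
def conjCl {m : ℕ} (x : Para m) : Cl m := algebraMap ℝ (Cl m) (x 0) - vec x

/-- The real axis of `ℝ^{m+1}`. -/
def realAxis (m : ℕ) : Set (Para m) := {x | ∀ j : Fin m, x j.succ = 0}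

/-- For `z = u + iv` and a unit vector `J` of `ℝ^m`, the point `u + J v` of `ℝ^{m+1}`. -/
def slicePoint {m : ℕ} (J : EuclideanSpace ℝ (Fin m)) (z : ℂ) : Para m :=
  WithLp.toLp 2 (Fin.cons z.re (fun j => J j * z.im))

/-- The set swept out by the copies `{u + J v : u + iv ∈ D}` of `D` as `J` runs over the unit
sphere of `ℝ^m`. -/
def axialSet (m : ℕ) (D : Set ℂ) : Set (Para m) :=
  ⋃ J ∈ Metric.sphere (0 : EuclideanSpace ℝ (Fin m)) 1, slicePoint J '' D

/-- Axially symmetric open sets. -/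
def IsAxiallySymmetric {m : ℕ} (Ω : Set (Para m)) : Prop :=
  IsOpen Ω ∧ ∃ D : Set ℂ, IsOpen D ∧ Ω = axialSet m D

/-! ### The kernel, the Teodorescu transform and the slice Cauchy-Riemann operator -/

/-- The slice Cauchy kernel `-(q² - 2 x₀ q + |x|²)⁻¹ (q - x̄)`. The inverse is the one of the
Clifford algebra; it is replaced by `0` where it does not exist, which for fixed `q` concerns only
the points `x` with `x₀ = q₀` and `vecNorm x = vecNorm q`. -/
def sliceCauchyKernel {m : ℕ} (q x : Para m) : Cl m :=
  -(Ring.inverse (toCl q ^ 2 - (2 * x 0) • toCl q + algebraMap ℝ (Cl m) (‖x‖ ^ 2)) *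
    (toCl q - conjCl x))

/-- The surface area of the unit sphere of `ℝ^m` (equal to `2` for `m = 1`). -/
def sphereArea (m : ℕ) : ℝ :=
  (volume : Measure (EuclideanSpace ℝ (Fin m))).toSphere.real Set.univ

/-- The kernel `K(q, x) = 2 S⁻¹(q, x) / (ω |x̲|^{m-1})`, where `ω` is the area of the unit sphere of
`ℝ^m`. The exponent `m - 1` is a natural number since the kernel is used for `1 ≤ m` only. -/
def kernelK {m : ℕ} (q x : Para m) : Cl m :=
  (2 / (sphereArea m * vecNorm x ^ (m - 1))) • sliceCauchyKernel q x

/-- The Teodorescu transform `T f (q) = -(1/2π) ∫_Ω K(q, x) f(x) dV(x)`. -/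
def teodorescu {m : ℕ} (Ω : Set (Para m)) (f : Para m → Cl m) (q : Para m) : Cl m :=
  -((1 / (2 * Real.pi)) • ∫ x in Ω, kernelK q x * f x)

/-- The slice Cauchy-Riemann operator `G = ∂/∂x₀ + (x̲ / |x̲|²) ∑ⱼ xⱼ ∂/∂xⱼ`, used off the real
axis. -/
def sliceCR {m : ℕ} (f : Para m → Cl m) (x : Para m) : Cl m :=
  lineDeriv ℝ f x (EuclideanSpace.single 0 1) +
    ((vecNorm x ^ 2)⁻¹ • vec x) *
      ∑ j : Fin m, x j.succ • lineDeriv ℝ f x (EuclideanSpace.single j.succ 1)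

end

end SliceClifford

namespace SliceClifford

/-! ### Integration in polar coordinates and singular integrals on the line -/

/-! Write `r`, `ρ` for the lengths of the vector parts of `q`, `x`. The quadratic in the kernel has
the form `α + β q̲` with real `α`, `β`, so it is inverted by its conjugate. The explicit quotient
shows that `S⁻¹(q, x)` is at most a constant over the half-plane distance from `(q₀, r)` to `(x₀,
ρ)` (`exists_norm_sliceCauchyKernel_le`).

Let `P` be conjugate to `p`, so `(p - 1)(P - 1) = 1`. By Hölder everything rests on `kernelInt`, the
integral of `|K(q, ·)|^P`. The half-plane distance dominates both coordinate differences. Splitting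
`P = t + s` and using polar coordinates therefore leaves the one-dimensional singularities `|x₀ -
q₀|^(-t)` and `|ρ - r|^(-s) ρ^(-a)`, where `a = (m - 1)(P - 1)` (`exists_kernelInt_le`). One can
have `s, t < 1` because `p > 2`, and `a < 1` because `p > m`. For `r > 0` the radial singularities
are separate and cost `r^(-s) + r^(-a)`. When they merge at the axis one needs `s + a < 1`, which
can be arranged when `p > m + 1`. The `L^p` bound amounts to integrability of `kernelInt ^ (p - 1)`
over the domain (`lintegral_kernelInt_rpow_lt_top`).

Off the closure, axial symmetry bounds the half-plane distance from below, so one may differentiate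
under the integral. The kernel is annihilated by `G` because its derivative along `q̲` is `q̲` times
its derivative along the real axis (`kernelDeriv_vecPart`). -/

theorem lintegral_fun_norm_addHaar {E : Type*} [NormedAddCommGroup E] [NormedSpace ℝ E]
    [MeasurableSpace E] [BorelSpace E] [FiniteDimensional ℝ E] [Nontrivial E]
    (μ : Measure E) [μ.IsAddHaarMeasure] {f : ℝ → ℝ≥0∞} (hf : Measurable f) :
    ∫⁻ x, f ‖x‖ ∂μ = μ.toSphere Set.univ *
      ∫⁻ y in Set.Ioi (0 : ℝ), ENNReal.ofReal (y ^ (Module.finrank ℝ E - 1)) * f y := by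
  calc
    ∫⁻ x, f ‖x‖ ∂μ = ∫⁻ x : ({(0)}ᶜ : Set E), f ‖x.1‖ ∂(μ.comap (↑)) := by
      rw [lintegral_subtype_comap (measurableSet_singleton _).compl fun x ↦ f (‖x‖),
        restrict_compl_singleton]
    _ = ∫⁻ x, f x.2 ∂μ.toSphere.prod (.volumeIoiPow (Module.finrank ℝ E - 1)) := by
      simpa using μ.measurePreserving_homeomorphUnitSphereProd.lintegral_comp_emb
        (Homeomorph.measurableEmbedding _) (f ∘ Subtype.val ∘ Prod.snd)
    _ = μ.toSphere Set.univ *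
        ∫⁻ x : Set.Ioi (0 : ℝ), f x ∂.volumeIoiPow (Module.finrank ℝ E - 1) := by
      rw [lintegral_prod _ (by fun_prop)]
      simp [mul_comm]
    _ = _ := by
      simp only [Measure.volumeIoiPow]
      rw [lintegral_withDensity_eq_lintegral_mul _ (by fun_prop) (by fun_prop)]
      congr 1
      exact lintegral_subtype_comap measurableSet_Ioi
        fun a ↦ ENNReal.ofReal (a ^ (Module.finrank ℝ E - 1)) * f a

theorem vecNorm_eq_norm {m : ℕ} (x : Para m) :
    vecNorm x = ‖(WithLp.toLp 2 (fun j : Fin m => x j.succ) : EuclideanSpace ℝ (Fin m))‖ := by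
  simp [vecNorm, EuclideanSpace.norm_eq]

theorem continuous_vecNorm {m : ℕ} : Continuous (vecNorm : Para m → ℝ) := by
  unfold vecNorm; fun_prop

theorem vecNorm_nonneg {m : ℕ} (x : Para m) : 0 ≤ vecNorm x := Real.sqrt_nonneg _

/-- Split off the real coordinate and use polar coordinates in the remaining `ℝ^m`. The Jacobian
`v^(m-1)` will partly cancel the weight of the kernel. -/
theorem lintegral_para {m : ℕ} (hm : 1 ≤ m) {g h : ℝ → ℝ≥0∞} (hg : Measurable g)
    (hh : Measurable h) :
    ∫⁻ x : Para m, g (x 0) * h (vecNorm x) = (∫⁻ y, g y) *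
      ((volume : Measure (EuclideanSpace ℝ (Fin m))).toSphere Set.univ *
        ∫⁻ v in Set.Ioi (0 : ℝ), ENNReal.ofReal (v ^ (m - 1)) * h v) := by
  have : Nonempty (Fin m) := ⟨⟨0, hm⟩⟩
  have h1 := lintegral_fun_norm_addHaar (volume : Measure (EuclideanSpace ℝ (Fin m))) hh
  rw [finrank_euclideanSpace, Fintype.card_fin] at h1
  rw [← h1]
  have hcont : Measurable fun x : Para m => g (x 0) * h (vecNorm x) :=
    (hg.comp (by fun_prop)).mul (hh.comp continuous_vecNorm.measurable)
  rw [← (PiLp.volume_preserving_toLp (Fin (m + 1))).lintegral_comp hcont]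
  refine ((volume_preserving_piFinSuccAbove (fun _ : Fin (m + 1) => ℝ) 0).symm.lintegral_comp
    (hcont.comp (WithLp.measurable_toLp 2 _))).symm.trans ?_
  have h2 := (PiLp.volume_preserving_toLp (Fin m)).lintegral_comp (hh.comp measurable_norm)
  simp only [Function.comp_apply] at h2
  rw [← h2, ← lintegral_prod_mul hg.aemeasurable (by fun_prop)]
  simp only [vecNorm_eq_norm]
  rfl

/-- A bound for the integrals of `‖y - c‖ ^ (-s)` over `(-R, R)`, uniform in `c`. -/
noncomputable def singBound (R s : ℝ) : ℝ≥0∞ :=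
  (∫⁻ y in Set.Ioo (-1 : ℝ) 1, ‖y‖ₑ ^ (-s)) + ENNReal.ofReal (R - -R)

theorem lintegral_sing_le {R s : ℝ} (hs : 0 ≤ s) (c : ℝ) :
    ∫⁻ y in Set.Ioo (-R) R, ‖y - c‖ₑ ^ (-s) ≤ singBound R s := by
  -- Within distance 1 of `c` the singular part is a translate of a fixed integral; elsewhere the
  -- integrand is at most 1. This makes the bound uniform in `c`.
  have h1 : ∀ y : ℝ, ‖y - c‖ₑ ^ (-s) ≤
      (Set.Ioo (-1 : ℝ) 1).indicator (fun y => ‖y‖ₑ ^ (-s)) (y - c) + 1 := by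
    intro y
    by_cases hy : y - c ∈ Set.Ioo (-1 : ℝ) 1
    · simp [Set.indicator_of_mem hy]
    · rw [Set.indicator_of_notMem hy, zero_add, ENNReal.rpow_neg, ENNReal.inv_le_one]
      rw [← ENNReal.one_rpow s]
      refine ENNReal.rpow_le_rpow ?_ hs
      rw [Set.mem_Ioo, ← abs_lt, not_lt] at hy
      rw [← ofReal_norm, Real.norm_eq_abs, ENNReal.one_le_ofReal]
      exact hy
  calc _ ≤ ∫⁻ y in Set.Ioo (-R) R,
        ((Set.Ioo (-1 : ℝ) 1).indicator (fun y => ‖y‖ₑ ^ (-s)) (y - c) + 1) :=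
        lintegral_mono h1
    _ = (∫⁻ y in Set.Ioo (-R) R,
        (Set.Ioo (-1 : ℝ) 1).indicator (fun y => ‖y‖ₑ ^ (-s)) (y - c)) +
          ENNReal.ofReal (R - -R) := by
        rw [lintegral_add_right _ measurable_const]; simp
    _ ≤ _ := by
        unfold singBound
        refine add_le_add ?_ le_rfl
        refine (setLIntegral_le_lintegral _ _).trans ?_
        rw [lintegral_sub_right_eq_self
          (fun y => (Set.Ioo (-1 : ℝ) 1).indicator (fun y => ‖y‖ₑ ^ (-s)) y) c,
          lintegral_indicator measurableSet_Ioo]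

theorem lintegral_rpow_Ioo_lt_top {c R : ℝ} (hc : -1 < c) :
    ∫⁻ v in Set.Ioo 0 R, ‖v‖ₑ ^ c < ∞ := by
  rcases le_or_gt R 0 with hR | hR
  · simp [Set.Ioo_eq_empty (not_lt.2 hR)]
  have h := (intervalIntegral.integrableOn_Ioo_rpow_iff hR).2 hc
  refine lt_of_eq_of_lt (setLIntegral_congr_fun measurableSet_Ioo ?_) h.hasFiniteIntegral
  intro v hv
  simp only
  rw [← ofReal_norm, ← ofReal_norm, Real.norm_of_nonneg hv.1.le,
    Real.norm_of_nonneg (Real.rpow_nonneg hv.1.le _), ENNReal.ofReal_rpow_of_pos hv.1]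

theorem singBound_lt_top {R s : ℝ} (hs : s < 1) : singBound R s < ∞ := by
  unfold singBound
  refine ENNReal.add_lt_top.2 ⟨?_, ENNReal.ofReal_lt_top⟩
  -- Polar coordinates in dimension one fold `(-1, 1)` onto `(0, 1)`, with trivial Jacobian.
  have h := lintegral_fun_norm_addHaar (volume : Measure ℝ)
    (f := (Set.Ioo (-1 : ℝ) 1).indicator (fun y => ‖y‖ₑ ^ (-s)))
    (by refine Measurable.indicator (by fun_prop) measurableSet_Ioo)
  rw [← lintegral_indicator measurableSet_Ioo]
  have e1 : ∀ y : ℝ, (Set.Ioo (-1 : ℝ) 1).indicator (fun y => ‖y‖ₑ ^ (-s)) y =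
      (Set.Ioo (-1 : ℝ) 1).indicator (fun y => ‖y‖ₑ ^ (-s)) ‖y‖ := by
    intro y
    simp only [Set.indicator, Set.mem_Ioo, ← abs_lt, Real.norm_eq_abs, abs_abs,
      Real.enorm_abs]
  rw [lintegral_congr e1, h]
  refine ENNReal.mul_lt_top (measure_lt_top _ _) ?_
  refine lt_of_le_of_lt ?_ (lintegral_rpow_Ioo_lt_top (R := 1) (c := -s) (by linarith))
  rw [← lintegral_indicator measurableSet_Ioi, ← lintegral_indicator measurableSet_Ioo]
  refine lintegral_mono fun y => ?_
  simp only [Set.indicator, Set.mem_Ioo, Set.mem_Ioi]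
  split_ifs with h1 h2 h3 <;> first | (simp; done) | (exfalso; grind)

theorem rpow_neg_mul_le_add {x y : ℝ≥0∞} {s a : ℝ} (hs : 0 ≤ s) (ha : 0 ≤ a) :
    x ^ (-s) * y ^ (-a) ≤ x ^ (-(s + a)) + y ^ (-(s + a)) := by
  have key : ∀ z : ℝ≥0∞, z ^ (-s) * z ^ (-a) ≤ z ^ (-(s + a)) := by
    intro z
    rw [ENNReal.rpow_neg, ENNReal.rpow_neg, ENNReal.rpow_neg, ENNReal.rpow_add_of_nonneg _ _ hs ha]
    rcases eq_or_ne (z ^ s * z ^ a) 0 with h | h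
    · simp [h]
    rcases eq_or_ne z ∞ with rfl | hz
    · rcases hs.eq_or_lt with rfl | hs'
      · simp
      · simp [hs']
    · rw [ENNReal.mul_inv]
      · exact Or.inl fun h0 => h (by rw [h0, zero_mul])
      · exact Or.inl (ENNReal.rpow_ne_top_of_nonneg hs hz)
  rcases le_total x y with h | h
  · refine le_trans ?_ le_self_add
    refine le_trans ?_ (key x)
    gcongr 1
    rw [ENNReal.rpow_neg, ENNReal.rpow_neg]
    gcongr
  · refine le_trans ?_ le_add_self
    refine le_trans ?_ (key y)
    gcongr 1
    rw [ENNReal.rpow_neg, ENNReal.rpow_neg]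
    gcongr

/-- Uniform in `r`, including `r = 0` where the two singularities coincide; the price is that
finiteness requires `s + a < 1`. -/
theorem lintegral_radial_le_of_add {R s a : ℝ} (hs : 0 ≤ s) (ha : 0 ≤ a) (r : ℝ) :
    ∫⁻ v in Set.Ioo 0 R, ‖v - r‖ₑ ^ (-s) * ‖v‖ₑ ^ (-a) ≤
      singBound R (s + a) + singBound R (s + a) := by
  have hsub : Set.Ioo 0 R ⊆ Set.Ioo (-R) R := fun v hv => ⟨by linarith [hv.1, hv.2], hv.2⟩
  calc _ ≤ ∫⁻ v in Set.Ioo (-R) R, (‖v - r‖ₑ ^ (-(s + a)) + ‖v - 0‖ₑ ^ (-(s + a))) := by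
        refine (lintegral_mono fun v => ?_).trans (lintegral_mono_set hsub)
        rw [sub_zero]
        exact rpow_neg_mul_le_add hs ha
    _ ≤ _ := by
        rw [lintegral_add_left (by fun_prop)]
        gcongr <;> exact lintegral_sing_le (by positivity) _

/-- Below `r / 2` the point stays `r / 2` away from `r`, above it stays `r / 2` away from `0`, so
only one factor is singular at a time. Finiteness needs only `s < 1` and `a < 1` separately, at the
cost of negative powers of `r`. -/
theorem lintegral_radial_le_of_pos {R s a r : ℝ} (hs : 0 ≤ s) (ha : 0 ≤ a) (hr : 0 < r) :
    ∫⁻ v in Set.Ioo 0 R, ‖v - r‖ₑ ^ (-s) * ‖v‖ₑ ^ (-a) ≤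
      ‖r / 2‖ₑ ^ (-s) * singBound R a + ‖r / 2‖ₑ ^ (-a) * singBound R s := by
  have hsub : Set.Ioo 0 R ⊆ Set.Ioo (-R) R := fun v hv => ⟨by linarith [hv.1, hv.2], hv.2⟩
  calc _ ≤ ∫⁻ v in Set.Ioo (-R) R, (‖r / 2‖ₑ ^ (-s) * ‖v - 0‖ₑ ^ (-a) +
          ‖r / 2‖ₑ ^ (-a) * ‖v - r‖ₑ ^ (-s)) := by
        refine (lintegral_mono fun v => ?_).trans (lintegral_mono_set hsub)
        rw [sub_zero]
        rcases le_total v (r / 2) with h | h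
        · refine le_trans ?_ le_self_add
          gcongr 1
          rw [ENNReal.rpow_neg, ENNReal.rpow_neg]
          gcongr
          rw [← ofReal_norm, ← ofReal_norm]
          apply ENNReal.ofReal_le_ofReal
          rw [Real.norm_of_nonneg (by positivity), Real.norm_eq_abs, abs_sub_comm]
          exact le_trans (by linarith) (le_abs_self _)
        · refine le_trans ?_ le_add_self
          rw [mul_comm]
          gcongr 1
          rw [ENNReal.rpow_neg, ENNReal.rpow_neg]
          gcongr
          rw [← ofReal_norm, ← ofReal_norm]
          apply ENNReal.ofReal_le_ofReal
          rw [Real.norm_of_nonneg (by positivity), Real.norm_eq_abs]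
          exact le_trans h (le_abs_self _)
    _ ≤ _ := by
        rw [lintegral_add_left (by fun_prop), lintegral_const_mul _ (by fun_prop),
          lintegral_const_mul _ (by fun_prop)]
        gcongr <;> exact lintegral_sing_le (by positivity) _

/-! ### The explicit form of the kernel -/

variable {m : ℕ}

theorem vecNorm_sq (x : Para m) : vecNorm x ^ 2 = ∑ j : Fin m, x j.succ ^ 2 :=
  Real.sq_sqrt (Finset.sum_nonneg fun _ _ => sq_nonneg _)

theorem norm_sq_eq (x : Para m) : ‖x‖ ^ 2 = x 0 ^ 2 + vecNorm x ^ 2 := by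
  rw [EuclideanSpace.norm_sq_eq, Fin.sum_univ_succ, vecNorm_sq]
  simp

theorem vec_eq_ι (x : Para m) :
    vec x = CliffordAlgebra.ι (negSumSq m) (fun j => x j.succ) := by
  have h : (fun j => x j.succ : Fin m → ℝ) =
      ∑ j : Fin m, x j.succ • (Pi.single j 1 : Fin m → ℝ) := by
    ext i
    simp [Finset.sum_apply, Pi.single_apply]
  rw [h, map_sum]
  simp only [map_smul]
  rfl

theorem vec_mul_self (x : Para m) : vec x * vec x = (-(vecNorm x ^ 2)) • (1 : Cl m) := by
  rw [vec_eq_ι, CliffordAlgebra.ι_sq_scalar, negSumSq_apply, vecNorm_sq, Algebra.algebraMap_eq_smul_one]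

theorem vec_eq_zero_of_vecNorm {x : Para m} (h : vecNorm x = 0) : vec x = 0 := by
  have h2 := vecNorm_sq x
  rw [h, zero_pow two_ne_zero, eq_comm,
    Finset.sum_eq_zero_iff_of_nonneg fun _ _ => sq_nonneg _] at h2
  refine Finset.sum_eq_zero fun j hj => ?_
  rw [pow_eq_zero_iff two_ne_zero |>.1 (h2 j hj), zero_smul]

/-- Multiplication of the Clifford algebra as a continuous bilinear map. -/
noncomputable def mulL (m : ℕ) : Cl m →L[ℝ] Cl m →L[ℝ] Cl m :=
  LinearMap.toContinuousLinearMap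
    ((LinearMap.toContinuousLinearMap :
      (Cl m →ₗ[ℝ] Cl m) ≃ₗ[ℝ] (Cl m →L[ℝ] Cl m)).toLinearMap ∘ₗ LinearMap.mul ℝ (Cl m))

@[simp] theorem mulL_apply (a b : Cl m) : mulL m a b = a * b := rfl

/-- Stands in for submultiplicativity, which the coordinate norm is not assumed to have. -/
theorem norm_mul_le_mulL (a b : Cl m) : ‖a * b‖ ≤ ‖mulL m‖ * ‖a‖ * ‖b‖ :=
  (mulL m).le_opNorm₂ a b

theorem continuous_mul_Cl : Continuous fun p : Cl m × Cl m => p.1 * p.2 :=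
  (mulL m).continuous₂

/-- The scalar part `α` of `q² - 2 x₀ q + |x|² = α + 2 (q₀ - x₀) q̲`. -/
noncomputable def scalarPart (q x : Para m) : ℝ :=
  (q 0 - x 0) ^ 2 - (∑ j : Fin m, q j.succ ^ 2) + ∑ j : Fin m, x j.succ ^ 2

/-- The scalar `(q² - 2 x₀ q + |x|²) (q̅² - 2 x₀ q̅ + |x|²)`. -/
noncomputable def kernelDen (q x : Para m) : ℝ :=
  scalarPart q x ^ 2 + (2 * (q 0 - x 0)) ^ 2 * ∑ j : Fin m, q j.succ ^ 2

/-- The numerator of the kernel. -/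
noncomputable def kernelNum (q x : Para m) : Cl m :=
  (scalarPart q x • (1 : Cl m) - (2 * (q 0 - x 0)) • vec q) * (toCl q - conjCl x)

/-- The squared distance in the closed upper half plane of the points representing `q` and `x`. -/
noncomputable def sliceDistSq (q x : Para m) : ℝ :=
  (q 0 - x 0) ^ 2 + (vecNorm q - vecNorm x) ^ 2

theorem scalarPart_eq (q x : Para m) :
    scalarPart q x = (q 0 - x 0) ^ 2 - vecNorm q ^ 2 + vecNorm x ^ 2 := by
  rw [scalarPart, vecNorm_sq, vecNorm_sq]

/-- The second factor is the squared distance from `(q₀, r)` to the mirror image `(x₀, -ρ)`. -/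
theorem kernelDen_eq (q x : Para m) :
    kernelDen q x = sliceDistSq q x * ((q 0 - x 0) ^ 2 + (vecNorm q + vecNorm x) ^ 2) := by
  rw [kernelDen, scalarPart_eq, ← vecNorm_sq, sliceDistSq]
  ring

theorem quadratic_eq (q x : Para m) :
    toCl q ^ 2 - (2 * x 0) • toCl q + algebraMap ℝ (Cl m) (‖x‖ ^ 2) =
      scalarPart q x • (1 : Cl m) + (2 * (q 0 - x 0)) • vec q := by
  have h := vec_mul_self q
  rw [scalarPart_eq, norm_sq_eq, toCl, sq, Algebra.algebraMap_eq_smul_one,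
    Algebra.algebraMap_eq_smul_one]
  simp only [mul_add, add_mul, smul_mul_assoc, mul_smul_comm, one_mul, mul_one, h]
  module

theorem quadratic_mul_conj (q x : Para m) :
    (scalarPart q x • (1 : Cl m) + (2 * (q 0 - x 0)) • vec q) *
      (scalarPart q x • (1 : Cl m) - (2 * (q 0 - x 0)) • vec q) = kernelDen q x • 1 := by
  have h := vec_mul_self q
  rw [kernelDen, ← vecNorm_sq]
  simp only [mul_sub, add_mul, smul_mul_assoc, mul_smul_comm, one_mul, mul_one, h]
  module

theorem conj_mul_quadratic (q x : Para m) :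
    (scalarPart q x • (1 : Cl m) - (2 * (q 0 - x 0)) • vec q) *
      (scalarPart q x • (1 : Cl m) + (2 * (q 0 - x 0)) • vec q) = kernelDen q x • 1 := by
  have h := vec_mul_self q
  rw [kernelDen, ← vecNorm_sq]
  simp only [mul_add, sub_mul, smul_mul_assoc, mul_smul_comm, one_mul, mul_one, h]
  module

/-- No hypothesis is needed: `kernelDen` is a sum of two squares, and when it vanishes the quadratic
itself is `0`, so both sides take the default value `0`. -/
theorem inverse_quadratic (q x : Para m) :
    Ring.inverse (scalarPart q x • (1 : Cl m) + (2 * (q 0 - x 0)) • vec q) =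
      (kernelDen q x)⁻¹ • (scalarPart q x • (1 : Cl m) - (2 * (q 0 - x 0)) • vec q) := by
  by_cases hn : kernelDen q x = 0
  · have hn' := hn
    rw [kernelDen, ← vecNorm_sq, ← mul_pow] at hn'
    have h1 : scalarPart q x = 0 := by
      nlinarith [sq_nonneg (scalarPart q x), sq_nonneg (2 * (q 0 - x 0) * vecNorm q)]
    have h2 : 2 * (q 0 - x 0) * vecNorm q = 0 := by
      nlinarith [sq_nonneg (scalarPart q x), sq_nonneg (2 * (q 0 - x 0) * vecNorm q)]
    have h3 : (2 * (q 0 - x 0)) • vec q = 0 := by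
      rcases mul_eq_zero.1 h2 with h | h
      · rw [h, zero_smul]
      · rw [vec_eq_zero_of_vecNorm h, smul_zero]
    rw [hn, h1, h3]
    simp
  · let u : (Cl m)ˣ := ⟨scalarPart q x • (1 : Cl m) + (2 * (q 0 - x 0)) • vec q,
      (kernelDen q x)⁻¹ • (scalarPart q x • (1 : Cl m) - (2 * (q 0 - x 0)) • vec q),
      by rw [mul_smul_comm, quadratic_mul_conj, smul_smul, inv_mul_cancel₀ hn, one_smul],
      by rw [smul_mul_assoc, conj_mul_quadratic, smul_smul, inv_mul_cancel₀ hn, one_smul]⟩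
    exact Ring.inverse_unit u

theorem sliceCauchyKernel_eq (q x : Para m) :
    sliceCauchyKernel q x = -((kernelDen q x)⁻¹ • kernelNum q x) := by
  rw [sliceCauchyKernel, quadratic_eq, inverse_quadratic, kernelNum, smul_mul_assoc]

theorem kernelNum_eq (q x : Para m) :
    kernelNum q x = ((q 0 - x 0) * ((q 0 - x 0) ^ 2 + vecNorm q ^ 2 + vecNorm x ^ 2)) • (1 : Cl m) -
      ((q 0 - x 0) ^ 2 + vecNorm q ^ 2 - vecNorm x ^ 2) • vec q +
      scalarPart q x • vec x - (2 * (q 0 - x 0)) • (vec q * vec x) := by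
  have h := vec_mul_self q
  rw [kernelNum, scalarPart_eq, toCl, conjCl, Algebra.algebraMap_eq_smul_one,
    Algebra.algebraMap_eq_smul_one]
  simp only [mul_sub, mul_add, sub_mul, smul_mul_assoc, mul_smul_comm, one_mul, mul_one, h]
  module

theorem norm_vec_le (x : Para m) : ‖vec x‖ ≤ vecNorm x * ∑ j : Fin m, ‖(e j : Cl m)‖ := by
  rw [Finset.mul_sum]
  refine (norm_sum_le _ _).trans (Finset.sum_le_sum fun j _ => ?_)
  rw [norm_smul]
  gcongr
  rw [Real.norm_eq_abs, vecNorm, ← Real.sqrt_sq_eq_abs]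
  exact Real.sqrt_le_sqrt (Finset.single_le_sum (f := fun j : Fin m => x j.succ ^ 2)
    (fun _ _ => sq_nonneg _) (Finset.mem_univ j))

/-- The left side collects the coefficients of `kernelNum_eq`. Each term contains `d` or `r - ρ`,
hence a factor at most the distance `s`; what remains is controlled by the other factor of
`kernelDen`. The first and last terms cost one unit each, the two middle ones together two, whence
the 4. -/
theorem kernel_estimate {d r ρ : ℝ} (hr : 0 ≤ r) (hρ : 0 ≤ ρ) :
    |d * (d ^ 2 + r ^ 2 + ρ ^ 2)| + |d ^ 2 + r ^ 2 - ρ ^ 2| * r + |d ^ 2 - r ^ 2 + ρ ^ 2| * ρ +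
      |2 * d| * (r * ρ) ≤ 4 * (√(d ^ 2 + (r - ρ) ^ 2) * (d ^ 2 + (r + ρ) ^ 2)) := by
  set s := √(d ^ 2 + (r - ρ) ^ 2) with hs
  have hB : 0 ≤ d ^ 2 + (r + ρ) ^ 2 := by positivity
  have h1 : |d| ≤ s := Real.abs_le_sqrt (by nlinarith [sq_nonneg (r - ρ)])
  have h2 : |r - ρ| ≤ s := Real.abs_le_sqrt (by nlinarith [sq_nonneg d])
  have hs0 : 0 ≤ s := Real.sqrt_nonneg _
  have hd : |d| ^ 2 = d ^ 2 := sq_abs d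
  have hd0 := abs_nonneg d
  have t1 : |d * (d ^ 2 + r ^ 2 + ρ ^ 2)| ≤ s * (d ^ 2 + (r + ρ) ^ 2) := by
    rw [abs_mul, abs_of_nonneg (by positivity : 0 ≤ d ^ 2 + r ^ 2 + ρ ^ 2)]
    exact mul_le_mul h1 (by nlinarith [mul_nonneg hr hρ]) (by positivity) hs0
  have t4 : |2 * d| * (r * ρ) ≤ s * (d ^ 2 + (r + ρ) ^ 2) := by
    rw [abs_mul, abs_two, mul_comm 2, mul_assoc]
    gcongr
    nlinarith [mul_nonneg hr hρ, sq_nonneg d, sq_nonneg r, sq_nonneg ρ]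
  have hdd : d ^ 2 * (r + ρ) ≤ s * (d ^ 2 + (r + ρ) ^ 2) := by
    calc d ^ 2 * (r + ρ) = |d| * (|d| * (r + ρ)) := by rw [← hd]; ring
      _ ≤ _ := by
        gcongr
        nlinarith [sq_nonneg (|d| - (r + ρ)), sq_nonneg |d|, sq_nonneg (r + ρ)]
  have hrr : |r ^ 2 - ρ ^ 2| * (r + ρ) ≤ s * (d ^ 2 + (r + ρ) ^ 2) := by
    calc |r ^ 2 - ρ ^ 2| * (r + ρ) = |r - ρ| * (r + ρ) ^ 2 := by
          rw [show r ^ 2 - ρ ^ 2 = (r - ρ) * (r + ρ) by ring, abs_mul,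
            abs_of_nonneg (add_nonneg hr hρ)]
          ring
      _ ≤ _ := by
        gcongr
        nlinarith [sq_nonneg d]
  have e1 : |d ^ 2 + r ^ 2 - ρ ^ 2| ≤ d ^ 2 + |r ^ 2 - ρ ^ 2| := by
    rw [add_sub_assoc]
    exact (abs_add_le _ _).trans (by rw [abs_of_nonneg (sq_nonneg d)])
  have e2 : |d ^ 2 - r ^ 2 + ρ ^ 2| ≤ d ^ 2 + |r ^ 2 - ρ ^ 2| := by
    rw [show d ^ 2 - r ^ 2 + ρ ^ 2 = d ^ 2 - (r ^ 2 - ρ ^ 2) by ring]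
    exact (abs_sub _ _).trans (by rw [abs_of_nonneg (sq_nonneg d)])
  have t2 := mul_le_mul_of_nonneg_right e1 hr
  have t3 := mul_le_mul_of_nonneg_right e2 hρ
  linarith

theorem exists_norm_sliceCauchyKernel_le (m : ℕ) :
    ∃ C : ℝ, 0 ≤ C ∧ ∀ q x : Para m, ‖sliceCauchyKernel q x‖ * √(sliceDistSq q x) ≤ C := by
  set c := ∑ j : Fin m, ‖(e j : Cl m)‖ with hc
  have hc0 : 0 ≤ c := Finset.sum_nonneg fun _ _ => norm_nonneg _
  set M := ‖(1 : Cl m)‖ + c + ‖mulL m‖ * c * c with hM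
  have hM1 : ‖(1 : Cl m)‖ ≤ M := by
    have : 0 ≤ ‖mulL m‖ * c * c := by positivity
    linarith
  have hM2 : c ≤ M := by
    have : 0 ≤ ‖mulL m‖ * c * c := by positivity
    linarith [norm_nonneg (1 : Cl m)]
  have hM3 : ‖mulL m‖ * c * c ≤ M := by linarith [norm_nonneg (1 : Cl m)]
  have hM0 : 0 ≤ M := hc0.trans hM2
  refine ⟨M * 4, by positivity, fun q x => ?_⟩
  have hr := vecNorm_nonneg q
  have hρ := vecNorm_nonneg x
  set A := sliceDistSq q x with hA
  set B := (q 0 - x 0) ^ 2 + (vecNorm q + vecNorm x) ^ 2 with hB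
  have hA0 : 0 ≤ A := by rw [hA, sliceDistSq]; positivity
  have hB0 : 0 ≤ B := by positivity
  have hq : ‖vec q‖ ≤ M * vecNorm q := (norm_vec_le q).trans (by rw [mul_comm]; gcongr)
  have hx : ‖vec x‖ ≤ M * vecNorm x := (norm_vec_le x).trans (by rw [mul_comm]; gcongr)
  have hqx : ‖vec q * vec x‖ ≤ M * (vecNorm q * vecNorm x) := by
    calc _ ≤ ‖mulL m‖ * ‖vec q‖ * ‖vec x‖ := norm_mul_le_mulL _ _
      _ ≤ ‖mulL m‖ * (vecNorm q * c) * (vecNorm x * c) := by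
        gcongr
        · exact norm_vec_le q
        · exact norm_vec_le x
      _ = (‖mulL m‖ * c * c) * (vecNorm q * vecNorm x) := by ring
      _ ≤ _ := by gcongr
  have hnum : ‖kernelNum q x‖ ≤ M * (4 * (√A * B)) := by
    have := kernel_estimate (d := q 0 - x 0) hr hρ
    refine le_trans ?_ (mul_le_mul_of_nonneg_left this hM0)
    rw [kernelNum_eq, scalarPart_eq]
    refine (norm_sub_le _ _).trans ?_
    refine (add_le_add_left (norm_add_le _ _) _).trans ?_
    refine (add_le_add_left (add_le_add_left (norm_sub_le _ _) _) _).trans ?_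
    simp only [norm_smul, Real.norm_eq_abs, mul_add]
    gcongr ?_ + ?_ + ?_ + ?_
    · rw [mul_comm M]; gcongr
    · rw [mul_left_comm]; gcongr
    · rw [mul_left_comm]; gcongr
    · rw [mul_left_comm]; gcongr
  rw [sliceCauchyKernel_eq, norm_neg, norm_smul, norm_inv, kernelDen_eq, ← hA, ← hB,
    Real.norm_of_nonneg (by positivity)]
  -- At distance zero the kernel has its default value `0`; this is why the bound is stated as a
  -- product and not as a quotient.
  by_cases h0 : A * B = 0
  · rw [h0]; simp; positivity
  · have hAB : 0 < A * B := lt_of_le_of_ne (by positivity) (Ne.symm h0)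
    rw [inv_mul_eq_div, div_mul_eq_mul_div, div_le_iff₀ hAB]
    calc _ ≤ M * (4 * (√A * B)) * √A := by gcongr
      _ = M * 4 * ((√A * √A) * B) := by ring
      _ = _ := by rw [Real.mul_self_sqrt hA0]

/-! ### Integrability of the kernel -/

theorem abs_apply_zero_le_norm (x : Para m) : |x 0| ≤ ‖x‖ := by
  rw [← abs_of_nonneg (norm_nonneg x), ← sq_le_sq, norm_sq_eq]
  linarith [sq_nonneg (vecNorm x)]

theorem vecNorm_le_norm (x : Para m) : vecNorm x ≤ ‖x‖ := by
  refine (le_abs_self _).trans ?_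
  rw [← abs_of_nonneg (norm_nonneg x), ← sq_le_sq, norm_sq_eq]
  linarith [sq_nonneg (x 0)]

theorem lintegral_para_le (hm : 1 ≤ m) {Ω : Set (Para m)} {R : ℝ}
    (hR : ∀ x ∈ Ω, ‖x‖ < R) {g h : ℝ → ℝ≥0∞} (hg : Measurable g) (hh : Measurable h) :
    ∫⁻ x in Ω, g (x 0) * h (vecNorm x) ≤ (∫⁻ y in Set.Ioo (-R) R, g y) *
      ((volume : Measure (EuclideanSpace ℝ (Fin m))).toSphere Set.univ *
        ∫⁻ v in Set.Ioo 0 R, ENNReal.ofReal (v ^ (m - 1)) * h v) := by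
  have hg' := hg.indicator (measurableSet_Ioo (a := -R) (b := R))
  have hh' := hh.indicator (measurableSet_Iio (a := R))
  have h0 := lintegral_para hm hg' hh'
  rw [lintegral_indicator measurableSet_Ioo] at h0
  have h1 : ∫⁻ v in Set.Ioi (0 : ℝ), ENNReal.ofReal (v ^ (m - 1)) * (Set.Iio R).indicator h v =
      ∫⁻ v in Set.Ioo 0 R, ENNReal.ofReal (v ^ (m - 1)) * h v := by
    rw [← lintegral_indicator measurableSet_Ioi, ← lintegral_indicator measurableSet_Ioo]
    refine lintegral_congr fun v => ?_
    simp only [Set.indicator, Set.mem_Ioi, Set.mem_Iio, Set.mem_Ioo]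
    split_ifs <;> first | rfl | (simp; done) | grind
  rw [h1] at h0
  rw [← h0]
  refine le_trans (setLIntegral_mono ((hg'.comp (by fun_prop)).mul
    (hh'.comp continuous_vecNorm.measurable)) fun x hx => ?_) (setLIntegral_le_lintegral Ω _)
  have hx0 := (abs_apply_zero_le_norm x).trans_lt (hR x hx)
  rw [Pi.mul_apply, Function.comp_apply, Function.comp_apply,
    Set.indicator_of_mem (show x 0 ∈ Set.Ioo (-R) R from abs_lt.1 hx0),
    Set.indicator_of_mem (show vecNorm x ∈ Set.Iio R from (vecNorm_le_norm x).trans_lt (hR x hx))]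

theorem ofReal_pow_mul_rpow (hm : 1 ≤ m) {v : ℝ} (hv : 0 < v) (c : ℝ) :
    ENNReal.ofReal (v ^ (m - 1)) * ‖v‖ₑ ^ c = ‖v‖ₑ ^ ((m : ℝ) - 1 + c) := by
  rw [← ofReal_norm, Real.norm_of_nonneg hv.le, ENNReal.ofReal_pow hv.le, ← ENNReal.rpow_natCast,
    ← ENNReal.rpow_add _ _ (by simpa using hv) ENNReal.ofReal_ne_top, Nat.cast_sub hm, Nat.cast_one]

theorem lintegral_vecNorm_rpow_lt_top (hm : 1 ≤ m) {Ω : Set (Para m)} {R : ℝ}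
    (hR : ∀ x ∈ Ω, ‖x‖ < R) {c : ℝ} (hc : -(m : ℝ) < c) :
    ∫⁻ x in Ω, ‖vecNorm x‖ₑ ^ c < ∞ := by
  have h := lintegral_para_le hm hR (g := fun _ => 1) (h := fun v => ‖v‖ₑ ^ c)
    measurable_const (by fun_prop)
  simp only [one_mul] at h
  refine h.trans_lt (ENNReal.mul_lt_top (by simp)
    (ENNReal.mul_lt_top (measure_lt_top _ _) ?_))
  rw [setLIntegral_congr_fun measurableSet_Ioo fun v hv => ofReal_pow_mul_rpow hm hv.1 c]
  exact lintegral_rpow_Ioo_lt_top (by linarith)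

/-- Joint measurability is what makes the transform measurable in `q`. It is read off the quotient
formula, whose numerator and denominator are continuous. -/
theorem stronglyMeasurable_kernelK_uncurry : StronglyMeasurable fun z : Para m × Para m => kernelK z.1 z.2 := by
  have h1 : Continuous fun z : Para m × Para m => scalarPart z.1 z.2 := by
    unfold scalarPart; fun_prop
  have hv : Continuous (vec : Para m → Cl m) := by
    unfold vec; fun_prop
  have h2 : Continuous fun z : Para m × Para m => kernelDen z.1 z.2 := by
    unfold kernelDen; fun_prop
  have h3 : Continuous fun z : Para m × Para m => kernelNum z.1 z.2 := by
    have ha : Continuous fun z : Para m × Para m =>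
        scalarPart z.1 z.2 • (1 : Cl m) - (2 * (z.1 0 - z.2 0)) • vec z.1 := by fun_prop
    have hb : Continuous fun z : Para m × Para m => toCl z.1 - conjCl z.2 := by
      unfold toCl conjCl
      simp only [Algebra.algebraMap_eq_smul_one]
      fun_prop
    exact continuous_mul_Cl.comp (ha.prodMk hb)
  have h4 : Measurable fun z : Para m × Para m => 2 / (sphereArea m * vecNorm z.2 ^ (m - 1)) := by
    have := continuous_vecNorm (m := m)
    fun_prop
  simp only [kernelK, sliceCauchyKernel_eq]
  exact h4.stronglyMeasurable.smul ((h2.measurable.inv.stronglyMeasurable.smul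
    h3.stronglyMeasurable).neg)

theorem sliceDistSq_nonneg (q x : Para m) : 0 ≤ sliceDistSq q x := by
  unfold sliceDistSq; positivity

theorem enorm_weight (hm : 1 ≤ m) {x : Para m} (hx : 0 < vecNorm x) :
    ‖2 / (sphereArea m * vecNorm x ^ (m - 1))‖ₑ =
      ‖2 / sphereArea m‖ₑ * ‖vecNorm x‖ₑ ^ (-((m : ℝ) - 1)) := by
  rw [← div_div, div_eq_mul_inv (2 / sphereArea m), enorm_mul, enorm_inv (by positivity),
    enorm_pow, ENNReal.rpow_neg, ← ENNReal.rpow_natCast, Nat.cast_sub hm, Nat.cast_one]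

theorem exists_enorm_kernelK_le (hm : 1 ≤ m) : ∃ C : ℝ≥0∞, C ≠ ∞ ∧ ∀ q x : Para m, 0 < vecNorm x →
    ‖kernelK q x‖ₑ ≤ C * ‖vecNorm x‖ₑ ^ (-((m : ℝ) - 1)) * ‖√(sliceDistSq q x)‖ₑ⁻¹ := by
  obtain ⟨C, hC0, hC⟩ := exists_norm_sliceCauchyKernel_le m
  -- Adding 1 keeps the constant nonzero, as division by a possibly zero distance in `ℝ≥0∞`
  -- requires.
  refine ⟨‖2 / sphereArea m‖ₑ * ENNReal.ofReal (C + 1),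
    ENNReal.mul_ne_top enorm_ne_top ENNReal.ofReal_ne_top, fun q x hx => ?_⟩
  have h1 : ‖sliceCauchyKernel q x‖ₑ ≤
      ENNReal.ofReal (C + 1) * ‖√(sliceDistSq q x)‖ₑ⁻¹ := by
    rw [← div_eq_mul_inv, ENNReal.le_div_iff_mul_le (Or.inr (by simp; positivity))
      (Or.inl enorm_ne_top), ← ofReal_norm, ← ofReal_norm, ← ENNReal.ofReal_mul (norm_nonneg _)]
    refine ENNReal.ofReal_le_ofReal ?_
    rw [Real.norm_of_nonneg (Real.sqrt_nonneg _)]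
    linarith [hC q x]
  rw [kernelK, enorm_smul, enorm_weight hm hx]
  calc _ ≤ ‖2 / sphereArea m‖ₑ * ‖vecNorm x‖ₑ ^ (-((m : ℝ) - 1)) *
        (ENNReal.ofReal (C + 1) * ‖√(sliceDistSq q x)‖ₑ⁻¹) := by gcongr
    _ = _ := by ring

theorem inv_sliceDist_rpow_le (q x : Para m) {s t : ℝ} (hs : 0 ≤ s) (ht : 0 ≤ t) :
    (‖√(sliceDistSq q x)‖ₑ⁻¹) ^ (t + s) ≤
      ‖x 0 - q 0‖ₑ ^ (-t) * ‖vecNorm x - vecNorm q‖ₑ ^ (-s) := by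
  have h1 : ‖x 0 - q 0‖ₑ ≤ ‖√(sliceDistSq q x)‖ₑ := by
    rw [← ofReal_norm, ← ofReal_norm, Real.norm_of_nonneg (Real.sqrt_nonneg _)]
    refine ENNReal.ofReal_le_ofReal (Real.abs_le_sqrt ?_)
    rw [sliceDistSq]
    nlinarith [sq_nonneg (vecNorm q - vecNorm x)]
  have h2 : ‖vecNorm x - vecNorm q‖ₑ ≤ ‖√(sliceDistSq q x)‖ₑ := by
    rw [← ofReal_norm, ← ofReal_norm, Real.norm_of_nonneg (Real.sqrt_nonneg _)]
    refine ENNReal.ofReal_le_ofReal (Real.abs_le_sqrt ?_)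
    rw [sliceDistSq]
    nlinarith [sq_nonneg (q 0 - x 0)]
  rw [ENNReal.rpow_neg, ENNReal.rpow_neg, ← ENNReal.mul_inv
    (Or.inr (ENNReal.rpow_ne_top_of_nonneg hs enorm_ne_top))
    (Or.inl (ENNReal.rpow_ne_top_of_nonneg ht enorm_ne_top)), ENNReal.inv_rpow,
    ENNReal.rpow_add_of_nonneg _ _ ht hs]
  gcongr

/-- The integral of the power `P` of the kernel `K(q, ·)`. -/
noncomputable def kernelInt (Ω : Set (Para m)) (P : ℝ) (q : Para m) : ℝ≥0∞ :=
  ∫⁻ x in Ω, ‖kernelK q x‖ₑ ^ P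

/-- The integral over `x₀` is bounded uniformly since `t < 1`. Radially, the Jacobian and the weight
combine to the exponent `(m - 1) - (m - 1)(t + s) = -(m - 1)(t + s - 1)`. -/
theorem exists_kernelInt_le (hm : 1 ≤ m) {Ω : Set (Para m)} {R : ℝ}
    (hΩ : MeasurableSet Ω) (hR : ∀ x ∈ Ω, ‖x‖ < R) (hpos : ∀ x ∈ Ω, 0 < vecNorm x)
    {s t : ℝ} (hs : 0 ≤ s) (ht : 0 ≤ t) (ht1 : t < 1) :
    ∃ C : ℝ≥0∞, C ≠ ∞ ∧ ∀ q, kernelInt Ω (t + s) q ≤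
      C * ∫⁻ v in Set.Ioo 0 R, ‖v - vecNorm q‖ₑ ^ (-s) * ‖v‖ₑ ^ (-(((m : ℝ) - 1) * (t + s - 1))) := by
  obtain ⟨C, hC, hK⟩ := exists_enorm_kernelK_le hm
  have hP : 0 ≤ t + s := by positivity
  set σ := (volume : Measure (EuclideanSpace ℝ (Fin m))).toSphere Set.univ
  refine ⟨C ^ (t + s) * (singBound R t * σ), ENNReal.mul_ne_top
    (ENNReal.rpow_ne_top_of_nonneg hP hC) (ENNReal.mul_ne_top (singBound_lt_top ht1).ne
      (measure_ne_top _ _)), fun q => ?_⟩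
  have h1 : kernelInt Ω (t + s) q ≤ ∫⁻ x in Ω, C ^ (t + s) * (‖x 0 - q 0‖ₑ ^ (-t) *
      (‖vecNorm x‖ₑ ^ (-((m : ℝ) - 1) * (t + s)) * ‖vecNorm x - vecNorm q‖ₑ ^ (-s))) := by
    refine setLIntegral_mono' hΩ fun x hx => ?_
    refine (ENNReal.rpow_le_rpow (hK q x (hpos x hx)) hP).trans ?_
    rw [ENNReal.mul_rpow_of_nonneg _ _ hP, ENNReal.mul_rpow_of_nonneg _ _ hP, mul_assoc,
      ← ENNReal.rpow_mul, mul_left_comm (‖x 0 - q 0‖ₑ ^ (-t))]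
    gcongr
    exact inv_sliceDist_rpow_le q x hs ht
  refine h1.trans ?_
  rw [lintegral_const_mul' _ _ (ENNReal.rpow_ne_top_of_nonneg hP hC)]
  have h2 := lintegral_para_le hm hR (g := fun y => ‖y - q 0‖ₑ ^ (-t))
    (h := fun v => ‖v‖ₑ ^ (-((m : ℝ) - 1) * (t + s)) * ‖v - vecNorm q‖ₑ ^ (-s))
    (by fun_prop) (by fun_prop)
  have h3 : ∫⁻ v in Set.Ioo 0 R, ENNReal.ofReal (v ^ (m - 1)) *
        (‖v‖ₑ ^ (-((m : ℝ) - 1) * (t + s)) * ‖v - vecNorm q‖ₑ ^ (-s)) =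
      ∫⁻ v in Set.Ioo 0 R, ‖v - vecNorm q‖ₑ ^ (-s) * ‖v‖ₑ ^ (-(((m : ℝ) - 1) * (t + s - 1))) := by
    refine setLIntegral_congr_fun measurableSet_Ioo fun v hv => ?_
    rw [← mul_assoc, ofReal_pow_mul_rpow hm hv.1, mul_comm]
    congr 2
    ring
  rw [h3] at h2
  calc _ ≤ C ^ (t + s) * (singBound R t * (σ * ∫⁻ v in Set.Ioo 0 R,
        ‖v - vecNorm q‖ₑ ^ (-s) * ‖v‖ₑ ^ (-(((m : ℝ) - 1) * (t + s - 1))))) := by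
        refine mul_le_mul_right (h2.trans ?_) _
        refine mul_le_mul_left ?_ _
        exact lintegral_sing_le ht _
    _ = _ := by ring

theorem exists_kernelInt_le_const (hm : 1 ≤ m) {Ω : Set (Para m)} {R : ℝ}
    (hΩ : MeasurableSet Ω) (hR : ∀ x ∈ Ω, ‖x‖ < R) (hpos : ∀ x ∈ Ω, 0 < vecNorm x)
    {P : ℝ} (hP1 : 1 < P) (hP : m * (P - 1) < 1) :
    ∃ C : ℝ≥0∞, C ≠ ∞ ∧ ∀ q, kernelInt Ω P q ≤ C := by
  have hm' : (1 : ℝ) ≤ m := by exact_mod_cast hm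
  -- The lower bound on `s` gives `t = P - s < 1`, the upper one gives `s + a < 1`; the two are
  -- compatible exactly when `m (P - 1) < 1`.
  obtain ⟨s, hs1, hs2⟩ := exists_between
    (show P - 1 < 1 - ((m : ℝ) - 1) * (P - 1) by linarith)
  have ha : 0 ≤ ((m : ℝ) - 1) * (P - 1) := mul_nonneg (by linarith) (by linarith)
  obtain ⟨C, hC, hK⟩ := exists_kernelInt_le hm hΩ hR hpos (s := s) (t := P - s)
    (by linarith) (by linarith) (by linarith)
  rw [sub_add_cancel] at hK
  have hb := (singBound_lt_top (R := R) (s := s + ((m : ℝ) - 1) * (P - 1)) (by linarith)).ne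
  refine ⟨_, ENNReal.mul_ne_top hC (ENNReal.add_ne_top.2 ⟨hb, hb⟩), fun q => (hK q).trans ?_⟩
  gcongr
  exact lintegral_radial_le_of_add (by linarith) ha _

theorem exists_kernelInt_le_rpow (hm : 1 ≤ m) {Ω : Set (Para m)} {R : ℝ}
    (hΩ : MeasurableSet Ω) (hR : ∀ x ∈ Ω, ‖x‖ < R) (hpos : ∀ x ∈ Ω, 0 < vecNorm x)
    {P s : ℝ} (hP1 : 1 < P) (hPm : ((m : ℝ) - 1) * (P - 1) < 1)
    (hs : P - 1 < s) (hs1 : s < 1) :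
    ∃ C : ℝ≥0∞, C ≠ ∞ ∧ ∀ q, 0 < vecNorm q → kernelInt Ω P q ≤
      C * (‖vecNorm q‖ₑ ^ (-s) + ‖vecNorm q‖ₑ ^ (-(((m : ℝ) - 1) * (P - 1)))) := by
  have hm' : (1 : ℝ) ≤ m := by exact_mod_cast hm
  set a := ((m : ℝ) - 1) * (P - 1) with ha_def
  have ha : 0 ≤ a := mul_nonneg (by linarith) (by linarith)
  obtain ⟨C, hC, hK⟩ := exists_kernelInt_le hm hΩ hR hpos (s := s) (t := P - s)
    (by linarith) (by linarith) (by linarith)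
  rw [sub_add_cancel] at hK
  have hba := (singBound_lt_top (R := R) hPm).ne
  have hbs := (singBound_lt_top (R := R) hs1).ne
  have h2 : ∀ c : ℝ, ‖(2⁻¹ : ℝ)‖ₑ ^ c ≠ ∞ := fun c =>
    ENNReal.rpow_ne_top_of_ne_zero (by simp) enorm_ne_top
  set D := ‖(2⁻¹ : ℝ)‖ₑ ^ (-s) * singBound R a + ‖(2⁻¹ : ℝ)‖ₑ ^ (-a) * singBound R s with hD
  refine ⟨C * D, ENNReal.mul_ne_top hC (ENNReal.add_ne_top.2
    ⟨ENNReal.mul_ne_top (h2 _) hba, ENNReal.mul_ne_top (h2 _) hbs⟩), fun q hq => ?_⟩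
  refine (hK q).trans ?_
  rw [mul_assoc]
  refine mul_le_mul_right ?_ _
  refine (lintegral_radial_le_of_pos (by linarith) ha hq).trans ?_
  rw [div_eq_mul_inv, enorm_mul, ENNReal.mul_rpow_of_ne_top enorm_ne_top enorm_ne_top,
    ENNReal.mul_rpow_of_ne_top enorm_ne_top enorm_ne_top, mul_add]
  refine add_le_add ?_ ?_
  · calc _ = (‖(2⁻¹ : ℝ)‖ₑ ^ (-s) * singBound R a) * ‖vecNorm q‖ₑ ^ (-s) := by ring
      _ ≤ _ := by gcongr; exact le_self_add
  · calc _ = (‖(2⁻¹ : ℝ)‖ₑ ^ (-a) * singBound R s) * ‖vecNorm q‖ₑ ^ (-a) := by ring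
      _ ≤ _ := by gcongr; exact le_add_self

theorem kernelInt_lt_top_of_pos (hm : 1 ≤ m) {Ω : Set (Para m)} {R : ℝ}
    (hΩ : MeasurableSet Ω) (hR : ∀ x ∈ Ω, ‖x‖ < R) (hpos : ∀ x ∈ Ω, 0 < vecNorm x)
    {P : ℝ} (hP1 : 1 < P) (hP2 : P < 2) (hPm : ((m : ℝ) - 1) * (P - 1) < 1)
    {q : Para m} (hq : 0 < vecNorm q) : kernelInt Ω P q < ∞ := by
  obtain ⟨s, hs, hs1⟩ := exists_between (show P - 1 < 1 by linarith)
  obtain ⟨C, hC, hK⟩ := exists_kernelInt_le_rpow hm hΩ hR hpos hP1 hPm hs hs1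
  have h2 : ∀ c : ℝ, ‖vecNorm q‖ₑ ^ c < ∞ := fun c =>
    (ENNReal.rpow_ne_top_of_ne_zero (by simpa using hq.ne') enorm_ne_top).lt_top
  exact (hK q hq).trans_lt (ENNReal.mul_lt_top hC.lt_top (ENNReal.add_lt_top.2 ⟨h2 _, h2 _⟩))

/-- Away from `q` only the weight is singular, and `(m - 1) P < m` is a rewriting of `hPm`. This
case covers real `q` off the closure. -/
theorem kernelInt_lt_top_of_le (hm : 1 ≤ m) {Ω : Set (Para m)} {R : ℝ}
    (hΩ : MeasurableSet Ω) (hR : ∀ x ∈ Ω, ‖x‖ < R) (hpos : ∀ x ∈ Ω, 0 < vecNorm x)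
    {P : ℝ} (hP1 : 1 < P) (hPm : ((m : ℝ) - 1) * (P - 1) < 1)
    {q : Para m} {δ : ℝ} (hδ : 0 < δ) (hq : ∀ x ∈ Ω, δ ^ 2 ≤ sliceDistSq q x) :
    kernelInt Ω P q < ∞ := by
  obtain ⟨C, hC, hK⟩ := exists_enorm_kernelK_le hm
  have hP0 : 0 ≤ P := by linarith
  have hD : C * ‖δ‖ₑ⁻¹ ≠ ∞ := ENNReal.mul_ne_top hC (by simpa using hδ.ne')
  have hDP := ENNReal.rpow_ne_top_of_nonneg hP0 hD
  have h1 : kernelInt Ω P q ≤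
      ∫⁻ x in Ω, (C * ‖δ‖ₑ⁻¹) ^ P * ‖vecNorm x‖ₑ ^ (-((m : ℝ) - 1) * P) := by
    refine setLIntegral_mono' hΩ fun x hx => ?_
    rw [ENNReal.rpow_mul, ← ENNReal.mul_rpow_of_nonneg _ _ hP0]
    refine ENNReal.rpow_le_rpow ((hK q x (hpos x hx)).trans ?_) hP0
    rw [mul_right_comm]
    gcongr
    rw [← ofReal_norm, ← ofReal_norm, Real.norm_of_nonneg hδ.le,
      Real.norm_of_nonneg (Real.sqrt_nonneg _)]
    exact ENNReal.ofReal_le_ofReal (Real.le_sqrt_of_sq_le (hq x hx))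
  refine h1.trans_lt ?_
  rw [lintegral_const_mul' _ _ hDP]
  refine ENNReal.mul_lt_top hDP.lt_top (lintegral_vecNorm_rpow_lt_top hm hR ?_)
  nlinarith

/-- If `m (P - 1) < 1`, the integrand is bounded on a set of finite measure. Otherwise it is
controlled by the powers `-s (p - 1)` and `-a (p - 1) = -(m - 1)` of the distance to the axis, which
are integrable when they exceed `-m`. -/
theorem lintegral_kernelInt_rpow_lt_top (hm : 1 ≤ m) {Ω : Set (Para m)} {R : ℝ}
    (hΩ : MeasurableSet Ω) (hR : ∀ x ∈ Ω, ‖x‖ < R) (hpos : ∀ x ∈ Ω, 0 < vecNorm x)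
    {p P : ℝ} (hp2 : 2 < p) (hpm : m < p) (hpP : (p - 1) * (P - 1) = 1) :
    ∫⁻ q in Ω, kernelInt Ω P q ^ (p - 1) < ∞ := by
  have hm' : (1 : ℝ) ≤ m := by exact_mod_cast hm
  have hP1 : 1 < P := by nlinarith
  have hP2 : P < 2 := by nlinarith
  have hPm : ((m : ℝ) - 1) * (P - 1) < 1 := by nlinarith
  have hp1 : 0 ≤ p - 1 := by linarith
  rcases lt_or_ge ((m : ℝ) * (P - 1)) 1 with hmP | hmP
  · obtain ⟨C, hC, hK⟩ := exists_kernelInt_le_const hm hΩ hR hpos hP1 hmP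
    have hfin : volume Ω < ∞ := by
      refine (measure_mono (t := Metric.ball 0 R) fun x hx => ?_).trans_lt measure_ball_lt_top
      simpa using hR x hx
    calc _ ≤ ∫⁻ q in Ω, C ^ (p - 1) := lintegral_mono fun q => by gcongr; exact hK q
      _ < ∞ := by
        rw [setLIntegral_const]
        exact ENNReal.mul_lt_top (ENNReal.rpow_lt_top_of_nonneg hp1 hC) hfin
  -- Since `(p - 1)(P - 1) = 1`, the bound `s < m (P - 1)` says `s (p - 1) < m`. There is room above
  -- `P - 1` because `P - 1 < 1 ≤ m (P - 1)` in this branch.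
  · obtain ⟨s, hs, hs1⟩ := exists_between
      (show P - 1 < min 1 (m * (P - 1)) by refine lt_min (by linarith) (by nlinarith))
    obtain ⟨C, hC, hK⟩ := exists_kernelInt_le_rpow hm hΩ hR hpos hP1 hPm hs
      (hs1.trans_le (min_le_left _ _))
    have hsm := hs1.trans_le (min_le_right _ _)
    set a := ((m : ℝ) - 1) * (P - 1) with ha
    have hC' : C ^ (p - 1) * 2 ^ (p - 1 - 1) ≠ ∞ :=
      ENNReal.mul_ne_top (ENNReal.rpow_ne_top_of_nonneg hp1 hC)
        (ENNReal.rpow_ne_top_of_nonneg (by linarith) (by simp))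
    calc _ ≤ ∫⁻ q in Ω, C ^ (p - 1) * 2 ^ (p - 1 - 1) *
          (‖vecNorm q‖ₑ ^ (-s * (p - 1)) + ‖vecNorm q‖ₑ ^ (-a * (p - 1))) := by
          refine setLIntegral_mono' hΩ fun q hq => ?_
          refine (ENNReal.rpow_le_rpow (hK q (hpos q hq)) hp1).trans ?_
          rw [ENNReal.mul_rpow_of_nonneg _ _ hp1, mul_assoc, ENNReal.rpow_mul, ENNReal.rpow_mul]
          gcongr
          exact ENNReal.rpow_add_le_mul_rpow_add_rpow _ _ (by linarith)
      _ < ∞ := by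
          rw [lintegral_const_mul' _ _ hC', lintegral_add_left]
          · refine ENNReal.mul_lt_top hC'.lt_top (ENNReal.add_lt_top.2 ⟨?_, ?_⟩) <;>
              refine lintegral_vecNorm_rpow_lt_top hm hR ?_
            · nlinarith
            · nlinarith
          · have := (continuous_vecNorm (m := m)).measurable
            fun_prop

/-! ### Existence and boundedness of the Teodorescu transform -/

theorem stronglyMeasurable_kernelK (q : Para m) : StronglyMeasurable (kernelK q) :=
  stronglyMeasurable_kernelK_uncurry.comp_measurable (g := fun x : Para m => (q, x)) measurable_prodMk_left

theorem aestronglyMeasurable_kernelK_mul {Ω : Set (Para m)} {f : Para m → Cl m}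
    (hf : AEStronglyMeasurable f (volume.restrict Ω)) (q : Para m) :
    AEStronglyMeasurable (fun x => kernelK q x * f x) (volume.restrict Ω) := by
  have h1 := stronglyMeasurable_kernelK q
  exact continuous_mul_Cl.comp_aestronglyMeasurable (h1.aestronglyMeasurable.prodMk hf)

theorem lintegral_kernelK_mul_le {Ω : Set (Para m)} {f : Para m → Cl m} {p P : ℝ}
    (hpP : p.HolderConjugate P)
    (hf : AEStronglyMeasurable f (volume.restrict Ω)) (q : Para m) :
    ∫⁻ x in Ω, ‖kernelK q x * f x‖ₑ ≤ ‖mulL m‖ₑ * (kernelInt Ω P q ^ (1 / P) *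
      eLpNorm f (ENNReal.ofReal p) (volume.restrict Ω)) := by
  have h1 := stronglyMeasurable_kernelK q
  rw [eLpNorm_eq_lintegral_rpow_enorm_toReal (by simpa using hpP.pos) ENNReal.ofReal_ne_top,
    ENNReal.toReal_ofReal hpP.nonneg]
  calc _ ≤ ∫⁻ x in Ω, ‖mulL m‖ₑ * (‖kernelK q x‖ₑ * ‖f x‖ₑ) := by
        refine lintegral_mono fun x => ?_
        simp only
        rw [← ofReal_norm, ← ofReal_norm, ← ofReal_norm, ← ofReal_norm,
          ← ENNReal.ofReal_mul (norm_nonneg _), ← ENNReal.ofReal_mul (norm_nonneg _), ← mul_assoc]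
        exact ENNReal.ofReal_le_ofReal (norm_mul_le_mulL _ _)
    _ = ‖mulL m‖ₑ * ∫⁻ x in Ω, ‖kernelK q x‖ₑ * ‖f x‖ₑ :=
        lintegral_const_mul' _ _ enorm_ne_top
    _ ≤ _ := by
        gcongr
        exact ENNReal.lintegral_mul_le_Lp_mul_Lq _ hpP.symm h1.enorm.aemeasurable hf.enorm

theorem integrableOn_kernelK_mul {Ω : Set (Para m)} {f : Para m → Cl m} {p P : ℝ}
    (hpP : p.HolderConjugate P)
    (hf : MemLp f (ENNReal.ofReal p) (volume.restrict Ω)) {q : Para m}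
    (hq : kernelInt Ω P q < ∞) : IntegrableOn (fun x => kernelK q x * f x) Ω := by
  refine ⟨aestronglyMeasurable_kernelK_mul hf.1 q,
    (lintegral_kernelK_mul_le hpP hf.1 q).trans_lt ?_⟩
  exact ENNReal.mul_lt_top enorm_lt_top (ENNReal.mul_lt_top
    (ENNReal.rpow_lt_top_of_nonneg (one_div_nonneg.2 hpP.symm.nonneg) hq.ne) hf.2)

theorem aestronglyMeasurable_teodorescu {Ω : Set (Para m)} {f : Para m → Cl m}
    (hf : AEStronglyMeasurable f (volume.restrict Ω)) :
    AEStronglyMeasurable (teodorescu Ω f) (volume.restrict Ω) := by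
  have h : AEStronglyMeasurable (fun z : Para m × Para m => kernelK z.1 z.2 * f z.2)
      ((volume.restrict Ω).prod (volume.restrict Ω)) :=
    continuous_mul_Cl.comp_aestronglyMeasurable
      (stronglyMeasurable_kernelK_uncurry.aestronglyMeasurable.prodMk hf.comp_snd)
  exact (h.integral_prod_right'.const_smul (1 / (2 * Real.pi))).neg

theorem exists_eLpNorm_teodorescu_le {Ω : Set (Para m)} {p P : ℝ} (hpP : p.HolderConjugate P)
    (hI : ∫⁻ q in Ω, kernelInt Ω P q ^ (p - 1) < ∞) :
    ∃ C : ℝ≥0, ∀ f : Para m → Cl m, MemLp f (ENNReal.ofReal p) (volume.restrict Ω) →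
      eLpNorm (teodorescu Ω f) (ENNReal.ofReal p) (volume.restrict Ω) ≤
        C * eLpNorm f (ENNReal.ofReal p) (volume.restrict Ω) := by
  set c : ℝ≥0∞ := ‖1 / (2 * Real.pi)‖ₑ * ‖mulL m‖ₑ with hc
  have hcT : c ≠ ∞ := ENNReal.mul_ne_top enorm_ne_top enorm_ne_top
  have hCT : c * (∫⁻ q in Ω, kernelInt Ω P q ^ (p - 1)) ^ (1 / p) ≠ ∞ :=
    ENNReal.mul_ne_top hcT (ENNReal.rpow_ne_top_of_nonneg (one_div_nonneg.2 hpP.nonneg) hI.ne)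
  refine ⟨(c * (∫⁻ q in Ω, kernelInt Ω P q ^ (p - 1)) ^ (1 / p)).toNNReal, fun f hf => ?_⟩
  rw [ENNReal.coe_toNNReal hCT]
  set N := eLpNorm f (ENNReal.ofReal p) (volume.restrict Ω) with hN
  have hNT : N ≠ ∞ := hf.2.ne
  have hpt : ∀ q, ‖teodorescu Ω f q‖ₑ ≤ c * N * kernelInt Ω P q ^ (1 / P) := by
    intro q
    rw [teodorescu, enorm_neg, enorm_smul]
    calc _ ≤ ‖1 / (2 * Real.pi)‖ₑ * (‖mulL m‖ₑ * (kernelInt Ω P q ^ (1 / P) * N)) := by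
          gcongr
          exact (enorm_integral_le_lintegral_enorm _).trans (lintegral_kernelK_mul_le hpP hf.1 q)
      _ = _ := by rw [hc]; ring
  have he : 1 / P * p = p - 1 := by
    rw [one_div_mul_eq_div, div_eq_iff hpP.symm.ne_zero, hpP.sub_one_mul_conj]
  rw [eLpNorm_eq_lintegral_rpow_enorm_toReal (by simpa using hpP.pos) ENNReal.ofReal_ne_top,
    ENNReal.toReal_ofReal hpP.nonneg]
  calc _ ≤ (∫⁻ q in Ω, (c * N) ^ p * kernelInt Ω P q ^ (p - 1)) ^ (1 / p) := by
        refine ENNReal.rpow_le_rpow (lintegral_mono fun q => ?_) (one_div_nonneg.2 hpP.nonneg)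
        refine (ENNReal.rpow_le_rpow (hpt q) hpP.nonneg).trans ?_
        rw [ENNReal.mul_rpow_of_nonneg _ _ hpP.nonneg, ← ENNReal.rpow_mul, he]
    _ = _ := by
        rw [lintegral_const_mul' _ _ (ENNReal.rpow_ne_top_of_nonneg hpP.nonneg
          (ENNReal.mul_ne_top hcT hNT)), ENNReal.mul_rpow_of_nonneg _ _
          (one_div_nonneg.2 hpP.nonneg), ← ENNReal.rpow_mul, mul_one_div_cancel hpP.ne_zero,
          ENNReal.rpow_one]
        ring

/-! ### Axial symmetry and the distance in the half plane -/

theorem vecNorm_pos_iff (x : Para m) : 0 < vecNorm x ↔ x ∉ realAxis m := by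
  rw [(vecNorm_nonneg x).lt_iff_ne', ne_eq, ← sq_eq_zero_iff, vecNorm_sq,
    Finset.sum_eq_zero_iff_of_nonneg fun _ _ => sq_nonneg _]
  simp [realAxis]

theorem vecNorm_toLp_cons (a c : ℝ) (v : Fin m → ℝ) :
    vecNorm (WithLp.toLp 2 (Fin.cons a (fun j => v j * c)) : Para m) =
      √(∑ j, v j ^ 2) * |c| := by
  simp only [vecNorm, Fin.cons_succ, mul_pow]
  rw [← Finset.sum_mul, Real.sqrt_mul' _ (sq_nonneg c), Real.sqrt_sq_eq_abs]

theorem mem_axialSet_of_eq {D : Set ℂ} {x y : Para m} (hx : x ∈ axialSet m D)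
    (hpos : 0 < vecNorm x) (h0 : y 0 = x 0) (hn : vecNorm y = vecNorm x) :
    y ∈ axialSet m D := by
  simp only [axialSet, Set.mem_iUnion, Set.mem_image, mem_sphere_zero_iff_norm] at hx ⊢
  obtain ⟨J, hJ, z, hz, rfl⟩ := hx
  have hv : vecNorm (slicePoint J z) = |z.im| := by
    have hJ' : √(∑ j, J j ^ 2) = 1 := by
      rw [← hJ, EuclideanSpace.norm_eq]
      simp
    rw [slicePoint, vecNorm_toLp_cons, hJ', one_mul]
  rw [hv] at hpos hn
  have hz0 : z.im ≠ 0 := abs_pos.1 hpos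
  -- Dividing by `z.im` with its sign lets the unit vector absorb the sign, so `D` need not be
  -- symmetric under conjugation.
  refine ⟨WithLp.toLp 2 fun j => y j.succ / z.im, ?_, z, hz, ?_⟩
  · rw [EuclideanSpace.norm_eq]
    simp only [norm_div, div_pow, Real.norm_eq_abs, sq_abs]
    rw [← Finset.sum_div, ← vecNorm_sq, hn, sq_abs, div_self (pow_ne_zero 2 hz0), Real.sqrt_one]
  · ext i
    refine Fin.cases ?_ (fun j => ?_) i
    · simpa [slicePoint] using h0.symm
    · simp [slicePoint, div_mul_cancel₀ _ hz0]

/-- Rotate `x` about the real axis into the half plane containing `q`. The rotated point stays in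
the axial set, and its Euclidean distance to `q` is the half-plane distance. -/
theorem sq_le_sliceDistSq_of_pos {D : Set ℂ} (hpos : ∀ x ∈ axialSet m D, 0 < vecNorm x)
    {q : Para m} (hq : 0 < vecNorm q) {δ : ℝ} (hδ : 0 ≤ δ)
    (hd : ∀ y ∈ axialSet m D, δ ≤ ‖q - y‖)
    {x : Para m} (hx : x ∈ axialSet m D) : δ ^ 2 ≤ sliceDistSq q x := by
  set y : Para m := WithLp.toLp 2 (Fin.cons (x 0) (fun j => q j.succ * (vecNorm x / vecNorm q)))
    with hy
  have hyx : y ∈ axialSet m D := by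
    refine mem_axialSet_of_eq hx (hpos x hx) (by simp [hy]) ?_
    rw [hy, vecNorm_toLp_cons, abs_of_nonneg (div_nonneg (vecNorm_nonneg _) (vecNorm_nonneg _))]
    exact mul_div_cancel₀ _ hq.ne'
  have h1 : ‖q - y‖ ^ 2 = sliceDistSq q x := by
    rw [norm_sq_eq, vecNorm_sq, sliceDistSq]
    have : ∀ j : Fin m, (q - y) j.succ ^ 2 = q j.succ ^ 2 * (1 - vecNorm x / vecNorm q) ^ 2 := by
      intro j
      simp only [hy, PiLp.sub_apply, Fin.cons_succ]
      ring
    simp only [this]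
    rw [← Finset.sum_mul, ← vecNorm_sq, ← mul_pow, mul_sub, mul_one, mul_div_cancel₀ _ hq.ne']
    simp [hy]
  rw [← h1]
  exact pow_le_pow_left₀ hδ (hd y hyx) 2

theorem sliceDistSq_of_real {q : Para m} (hq : q ∈ realAxis m) (x : Para m) :
    sliceDistSq q x = ‖q - x‖ ^ 2 := by
  have h0 : vecNorm q = 0 :=
    le_antisymm (not_lt.1 fun h => (vecNorm_pos_iff q).1 h hq) (vecNorm_nonneg q)
  rw [norm_sq_eq, sliceDistSq, h0, vecNorm_sq (q - x)]
  have : ∀ j : Fin m, (q - x) j.succ ^ 2 = x j.succ ^ 2 := by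
    intro j
    rw [PiLp.sub_apply, hq j]; ring
  simp only [this, ← vecNorm_sq]
  rw [PiLp.sub_apply]
  ring

/-! ### Differentiation of the kernel -/

/-- The embedding of paravectors as a continuous linear map. -/
noncomputable def toClL (m : ℕ) : Para m →L[ℝ] Cl m :=
  LinearMap.toContinuousLinearMap
    { toFun := toCl
      map_add' := fun x y => by
        simp only [toCl, vec, PiLp.add_apply, map_add, add_smul, Finset.sum_add_distrib]
        abel
      map_smul' := fun c x => by
        simp only [toCl, vec, PiLp.smul_apply, smul_eq_mul, Algebra.algebraMap_eq_smul_one,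
          mul_smul, smul_add, Finset.smul_sum, RingHom.id_apply] }

@[simp] theorem toClL_apply (x : Para m) : toClL m x = toCl x := rfl

theorem contDiff_kernelDen : ContDiff ℝ 1 fun z : Para m × Para m => kernelDen z.1 z.2 := by
  unfold kernelDen scalarPart
  fun_prop

theorem contDiff_kernelNum : ContDiff ℝ 1 fun z : Para m × Para m => kernelNum z.1 z.2 := by
  have ha : ContDiff ℝ 1 fun z : Para m × Para m =>
      scalarPart z.1 z.2 • (1 : Cl m) - (2 * (z.1 0 - z.2 0)) • vec z.1 := by
    unfold scalarPart vec; fun_prop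
  have hb : ContDiff ℝ 1 fun z : Para m × Para m => toCl z.1 - conjCl z.2 := by
    unfold toCl conjCl vec
    simp only [Algebra.algebraMap_eq_smul_one]
    fun_prop
  exact (mulL m).isBoundedBilinearMap.contDiff.comp (ha.prodMk hb)

theorem contDiffAt_sliceCauchyKernel {z : Para m × Para m} (hz : kernelDen z.1 z.2 ≠ 0) :
    ContDiffAt ℝ 1 (fun z : Para m × Para m => sliceCauchyKernel z.1 z.2) z := by
  simp only [sliceCauchyKernel_eq]
  exact ((contDiff_kernelDen.contDiffAt.inv hz).smul contDiff_kernelNum.contDiffAt).neg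

/-- The derivative of the slice Cauchy kernel in its first variable. -/
noncomputable def kernelDeriv (q x : Para m) : Para m →L[ℝ] Cl m :=
  (fderiv ℝ (fun z : Para m × Para m => sliceCauchyKernel z.1 z.2) (q, x)).comp
    (ContinuousLinearMap.inl ℝ (Para m) (Para m))

theorem hasFDerivAt_sliceCauchyKernel {q x : Para m} (h : kernelDen q x ≠ 0) :
    HasFDerivAt (fun q => sliceCauchyKernel q x) (kernelDeriv q x) q := by
  have h1 := ((contDiffAt_sliceCauchyKernel (z := (q, x)) h).differentiableAt
    one_ne_zero).hasFDerivAt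
  exact HasFDerivAt.comp (f := fun q' => (q', x)) q h1 (hasFDerivAt_prodMk_left q x)

/-- Continuity jointly in `(q, x)` serves both the compactness bound and measurability in `x`. -/
theorem continuousAt_kernelDeriv {z : Para m × Para m} (h : kernelDen z.1 z.2 ≠ 0) :
    ContinuousAt (fun z : Para m × Para m => kernelDeriv z.1 z.2) z := by
  have h1 := (contDiffAt_sliceCauchyKernel h).continuousAt_fderiv one_ne_zero
  exact h1.clm_comp continuousAt_const

/-- The quadratic polynomial `q² - 2 x₀ q + |x|²`. -/
noncomputable def quadratic (q x : Para m) : Cl m :=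
  toCl q * toCl q - (2 * x 0) • toCl q + algebraMap ℝ (Cl m) (‖x‖ ^ 2)

theorem quadratic_eq_add (q x : Para m) :
    quadratic q x = scalarPart q x • (1 : Cl m) + (2 * (q 0 - x 0)) • vec q := by
  rw [← quadratic_eq, sq, quadratic]

theorem quadratic_mul_sliceCauchyKernel {q x : Para m} (h : kernelDen q x ≠ 0) :
    quadratic q x * sliceCauchyKernel q x = -(toCl q - conjCl x) := by
  rw [sliceCauchyKernel_eq, quadratic_eq_add, kernelNum, mul_neg, mul_smul_comm, ← mul_assoc,
    quadratic_mul_conj, smul_mul_assoc, one_mul, smul_smul, inv_mul_cancel₀ h, one_smul]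

theorem vec_commute_toCl (q : Para m) : Commute (vec q) (toCl q) := by
  rw [toCl]
  exact (Algebra.commute_algebraMap_right _ _).add_right (Commute.refl _)

theorem vec_commute_quadratic (q x : Para m) : Commute (vec q) (quadratic q x) := by
  rw [quadratic]
  have h := vec_commute_toCl q
  exact ((h.mul_right h).sub_right (h.smul_right _)).add_right
    (Algebra.commute_algebraMap_right _ _)

/-- Differentiate the implicit equation `quadratic * S⁻¹ = -(q - x̄)`, valid near `q`, rather than
the quotient. The order of factors is kept since `v` and `q` need not commute. -/
theorem quadratic_mul_kernelDeriv {q x : Para m} (h : kernelDen q x ≠ 0) (v : Para m) :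
    quadratic q x * kernelDeriv q x v = -toCl v -
      (toCl q * toCl v + toCl v * toCl q - (2 * x 0) • toCl v) * sliceCauchyKernel q x := by
  have ht := (toClL m).hasFDerivAt (x := q)
  have hN := ((((mulL m).hasFDerivAt_of_bilinear ht ht).sub (ht.const_smul (2 * x 0))).add_const
    (algebraMap ℝ (Cl m) (‖x‖ ^ 2)))
  have h1 := (mulL m).hasFDerivAt_of_bilinear hN (hasFDerivAt_sliceCauchyKernel h)
  have hev : ∀ᶠ q' in nhds q, kernelDen q' x ≠ 0 := by
    have hc : ContinuousAt (fun q' => kernelDen q' x) q :=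
      (contDiff_kernelDen.continuous.comp (Continuous.prodMk_left x)).continuousAt
    exact hc.eventually_ne h
  have h2 : HasFDerivAt (fun q' : Para m => -(toCl q' - conjCl x)) (-(toClL m)) q :=
    (ht.sub_const (conjCl x)).neg
  have h3 := h1.unique (h2.congr_of_eventuallyEq
    (hev.mono fun q' hq' => quadratic_mul_sliceCauchyKernel hq'))
  have h4 := DFunLike.congr_fun h3 v
  have h5 : quadratic q x * kernelDeriv q x v +
      (toCl q * toCl v + toCl v * toCl q - (2 * x 0) • toCl v) * sliceCauchyKernel q x =
      -toCl v := h4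
  rw [← h5, add_sub_cancel_right]

/-- The point `(0, q₁, …, q_m)`. -/
noncomputable def vecPart (q : Para m) : Para m :=
  ∑ j : Fin m, q j.succ • EuclideanSpace.single j.succ (1 : ℝ)

theorem toCl_vecPart (q : Para m) : toCl (vecPart q) = vec q := by
  rw [← toClL_apply, vecPart, map_sum, vec]
  refine Finset.sum_congr rfl fun j _ => ?_
  rw [map_smul, toClL_apply, toCl, vec, Finset.sum_eq_single j]
  · simp
  · intro i _ hi
    simp [hi]
  · simp

theorem toCl_single_zero : toCl (EuclideanSpace.single 0 1 : Para m) = 1 := by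
  rw [toCl, vec, Finset.sum_eq_zero]
  · simp
  · intro j _
    simp

/-- Both directions `1` and `q̲` commute with `q`, so the right side of `quadratic_mul_kernelDeriv`
for `q̲` is `q̲` times that for `1`. As `q̲` also commutes with the quadratic, it can be moved past
it and the quadratic cancelled. -/
theorem kernelDeriv_vecPart {q x : Para m} (h : kernelDen q x ≠ 0) :
    kernelDeriv q x (vecPart q) = vec q * kernelDeriv q x (EuclideanSpace.single 0 1) := by
  have h1 := quadratic_mul_kernelDeriv h (vecPart q)
  have h0 := quadratic_mul_kernelDeriv h (EuclideanSpace.single 0 1)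
  rw [toCl_vecPart] at h1
  rw [toCl_single_zero] at h0
  have hc := (vec_commute_toCl q).eq
  have h2 : quadratic q x * kernelDeriv q x (vecPart q) =
      quadratic q x * (vec q * kernelDeriv q x (EuclideanSpace.single 0 1)) := by
    rw [h1, ← mul_assoc, ← (vec_commute_quadratic q x).eq, mul_assoc, h0, ← hc, mul_sub,
      ← mul_assoc]
    simp only [mul_one, one_mul, mul_sub, mul_add, mul_neg, mul_smul_comm]
  -- Multiplying by the conjugate turns the quadratic into the nonzero scalar `kernelDen q x`.
  have h3 := congrArg (fun y => (scalarPart q x • (1 : Cl m) - (2 * (q 0 - x 0)) • vec q) * y) h2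
  simp only [← mul_assoc, quadratic_eq_add, conj_mul_quadratic] at h3
  simp only [smul_mul_assoc, one_mul] at h3
  exact smul_right_injective _ h h3

/-! ### The Teodorescu transform off the closure of the domain -/

theorem memLp_weight (hm : 1 ≤ m) {Ω : Set (Para m)} {R : ℝ}
    (hΩ : MeasurableSet Ω) (hR : ∀ x ∈ Ω, ‖x‖ < R) (hpos : ∀ x ∈ Ω, 0 < vecNorm x)
    {P : ℝ} (hP1 : 1 < P) (hPm : ((m : ℝ) - 1) * (P - 1) < 1) :
    MemLp (fun x : Para m => 2 / (sphereArea m * vecNorm x ^ (m - 1))) (ENNReal.ofReal P)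
      (volume.restrict Ω) := by
  have hP0 : 0 < P := by linarith
  have hmeas : Measurable fun x : Para m => 2 / (sphereArea m * vecNorm x ^ (m - 1)) := by
    have := (continuous_vecNorm (m := m)).measurable
    fun_prop
  refine ⟨hmeas.aestronglyMeasurable, ?_⟩
  rw [eLpNorm_lt_top_iff_lintegral_rpow_enorm_lt_top (by simpa using hP0) ENNReal.ofReal_ne_top,
    ENNReal.toReal_ofReal hP0.le]
  have hD : ‖2 / sphereArea m‖ₑ ^ P ≠ ∞ := ENNReal.rpow_ne_top_of_nonneg hP0.le enorm_ne_top
  have h1 : ∫⁻ x in Ω, ‖2 / (sphereArea m * vecNorm x ^ (m - 1))‖ₑ ^ P =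
      ∫⁻ x in Ω, ‖2 / sphereArea m‖ₑ ^ P * ‖vecNorm x‖ₑ ^ (-((m : ℝ) - 1) * P) := by
    refine setLIntegral_congr_fun hΩ fun x hx => ?_
    rw [enorm_weight hm (hpos x hx), ENNReal.mul_rpow_of_nonneg _ _ hP0.le, ← ENNReal.rpow_mul]
  rw [h1, lintegral_const_mul' _ _ hD]
  refine ENNReal.mul_lt_top hD.lt_top (lintegral_vecNorm_rpow_lt_top hm hR ?_)
  nlinarith

theorem pow_four_le_kernelDen {q x : Para m} {ε : ℝ} (hε : 0 < ε) (h : ε ^ 2 ≤ sliceDistSq q x) :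
    ε ^ 4 ≤ kernelDen q x := by
  have h1 : sliceDistSq q x ≤ (q 0 - x 0) ^ 2 + (vecNorm q + vecNorm x) ^ 2 := by
    rw [sliceDistSq]
    nlinarith [mul_nonneg (vecNorm_nonneg q) (vecNorm_nonneg x)]
  rw [kernelDen_eq, show ε ^ 4 = ε ^ 2 * ε ^ 2 by ring]
  exact mul_le_mul h (h.trans h1) (by positivity) (sliceDistSq_nonneg q x)

theorem exists_norm_kernelDeriv_le {Ω : Set (Para m)} (hΩb : Bornology.IsBounded Ω)
    {q : Para m} {ε : ℝ} (hε : 0 < ε)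
    (hd : ∀ q' ∈ Metric.closedBall q ε, ∀ x ∈ Ω, ε ^ 2 ≤ sliceDistSq q' x) :
    ∃ M : ℝ, ∀ q' ∈ Metric.closedBall q ε, ∀ x ∈ Ω, ‖kernelDeriv q' x‖ ≤ M := by
  have hK : IsCompact (Metric.closedBall q ε ×ˢ closure Ω) :=
    (isCompact_closedBall q ε).prod hΩb.isCompact_closure
  have hne : ∀ z ∈ Metric.closedBall q ε ×ˢ closure Ω, kernelDen z.1 z.2 ≠ 0 := by
    rintro ⟨q', x⟩ ⟨hq', hx⟩
    -- The lower bound on the denominator passes to the closure. That the closure may meet the real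
    -- axis does no harm, because `kernelDeriv` does not contain the singular weight.
    have hcl : IsClosed {x : Para m | ε ^ 4 ≤ kernelDen q' x} :=
      isClosed_le continuous_const (Continuous.comp
        (g := fun z : Para m × Para m => kernelDen z.1 z.2) (f := fun x => (q', x))
        contDiff_kernelDen.continuous (Continuous.prodMk_right q'))
    have h1 : x ∈ {x : Para m | ε ^ 4 ≤ kernelDen q' x} :=
      closure_minimal (fun y hy => pow_four_le_kernelDen hε (hd q' hq' y hy)) hcl hx
    exact ((pow_pos hε 4).trans_le h1).ne'
  obtain ⟨M, hM⟩ := hK.exists_bound_of_continuousOn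
    (f := fun z : Para m × Para m => kernelDeriv z.1 z.2)
    fun z hz => (continuousAt_kernelDeriv (hne z hz)).continuousWithinAt
  exact ⟨M, fun q' hq' x hx => hM (q', x) ⟨hq', subset_closure hx⟩⟩

/-- The derivative of `q ↦ K(q, x) a`. -/
noncomputable def kernelKMulDeriv (q x : Para m) (a : Cl m) : Para m →L[ℝ] Cl m :=
  (2 / (sphereArea m * vecNorm x ^ (m - 1))) • ((mulL m).flip a).comp (kernelDeriv q x)

theorem hasFDerivAt_kernelK_mul {q x : Para m} (h : kernelDen q x ≠ 0) (a : Cl m) :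
    HasFDerivAt (fun q => kernelK q x * a) (kernelKMulDeriv q x a) q := by
  have h1 := (((mulL m).flip a).hasFDerivAt.comp q (hasFDerivAt_sliceCauchyKernel h)).const_smul
    (2 / (sphereArea m * vecNorm x ^ (m - 1)))
  refine h1.congr_of_eventuallyEq (Filter.Eventually.of_forall fun q' => ?_)
  simp [kernelK]

/-- The singular weight does not depend on `q` and lies in `L^P`, while the derivative of the slice
kernel is bounded. A multiple of weight times `|f|` is thus an integrable majorant by Hölder. -/
theorem hasFDerivAt_teodorescu (hm : 1 ≤ m) {Ω : Set (Para m)} {R : ℝ}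
    (hΩ : MeasurableSet Ω) (hR : ∀ x ∈ Ω, ‖x‖ < R) (hpos : ∀ x ∈ Ω, 0 < vecNorm x)
    {p P : ℝ} (hpP : p.HolderConjugate P) (hPm : ((m : ℝ) - 1) * (P - 1) < 1)
    {f : Para m → Cl m} (hf : MemLp f (ENNReal.ofReal p) (volume.restrict Ω))
    {q : Para m} {ε : ℝ} (hε : 0 < ε)
    (hd : ∀ q' ∈ Metric.closedBall q ε, ∀ x ∈ Ω, ε ^ 2 ≤ sliceDistSq q' x) :
    Integrable (fun x => kernelKMulDeriv q x (f x)) (volume.restrict Ω) ∧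
      HasFDerivAt (teodorescu Ω f)
        (-((1 / (2 * Real.pi)) • ∫ x in Ω, kernelKMulDeriv q x (f x))) q := by
  have hqq : q ∈ Metric.closedBall q ε := Metric.mem_closedBall_self hε.le
  have hne : ∀ q' ∈ Metric.closedBall q ε, ∀ x ∈ Ω, kernelDen q' x ≠ 0 := fun q' hq' x hx =>
    ((pow_pos hε 4).trans_le (pow_four_le_kernelDen hε (hd q' hq' x hx))).ne'
  have hΩb : Bornology.IsBounded Ω := Metric.isBounded_ball.subset (t := Metric.ball 0 R)
    fun x hx => by simpa using hR x hx
  obtain ⟨M, hM⟩ := exists_norm_kernelDeriv_le hΩb hε hd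
  have hw := memLp_weight hm hΩ hR hpos hpP.symm.lt hPm
  have : (ENNReal.ofReal P).HolderConjugate (ENNReal.ofReal p) := hpP.symm.ennrealOfReal
  have hbi : Integrable (fun x => ‖2 / (sphereArea m * vecNorm x ^ (m - 1))‖ * ‖f x‖)
      (volume.restrict Ω) := hw.norm.integrable_mul hf.norm
  have hbound : ∀ᵐ x ∂volume.restrict Ω, ∀ q' ∈ Metric.closedBall q ε,
      ‖kernelKMulDeriv q' x (f x)‖ ≤
        (‖(mulL m).flip‖ * M) * (‖2 / (sphereArea m * vecNorm x ^ (m - 1))‖ * ‖f x‖) := by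
    filter_upwards [ae_restrict_mem hΩ] with x hx q' hq'
    rw [kernelKMulDeriv, norm_smul]
    calc _ ≤ ‖2 / (sphereArea m * vecNorm x ^ (m - 1))‖ *
          ((‖(mulL m).flip‖ * ‖f x‖) * M) := by
          gcongr
          refine (ContinuousLinearMap.opNorm_comp_le _ _).trans ?_
          gcongr
          · exact (mulL m).flip.le_opNorm _
          · exact hM q' hq' x hx
      _ = _ := by ring
  have hmeas' : AEStronglyMeasurable (fun x => kernelKMulDeriv q x (f x)) (volume.restrict Ω) := by
    have h1 : ContinuousOn (fun x => kernelDeriv q x) Ω := fun x hx =>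
      (ContinuousAt.comp (f := fun x => (q, x)) (continuousAt_kernelDeriv (hne q hqq x hx))
        (Continuous.prodMk_right q).continuousAt).continuousWithinAt
    have h2 := h1.aestronglyMeasurable (μ := volume) hΩ
    have h3 := (mulL m).flip.continuous.comp_aestronglyMeasurable hf.1
    exact hw.1.smul ((ContinuousLinearMap.compL ℝ (Para m) (Cl m)
      (Cl m)).aestronglyMeasurable_comp₂ h3 h2)
  have hint : IntegrableOn (fun x => kernelK q x * f x) Ω :=
    integrableOn_kernelK_mul hpP hf
      (kernelInt_lt_top_of_le hm hΩ hR hpos hpP.symm.lt hPm hε (hd q hqq))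
  refine ⟨(hbi.const_mul _).mono' hmeas' (hbound.mono fun x hx => hx q hqq), ?_⟩
  have hmain := hasFDerivAt_integral_of_dominated_of_fderiv_le
    (F := fun q x => kernelK q x * f x) (F' := fun q x => kernelKMulDeriv q x (f x))
    (μ := volume.restrict Ω) (Metric.closedBall_mem_nhds q hε)
    (Filter.Eventually.of_forall fun q' => aestronglyMeasurable_kernelK_mul hf.1 q')
    hint hmeas' hbound (hbi.const_mul _)
    (by
      filter_upwards [ae_restrict_mem hΩ] with x hx q' hq'
      exact hasFDerivAt_kernelK_mul (hne q' hq' x hx) (f x))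
  exact (hmain.const_smul (1 / (2 * Real.pi))).neg

/-- Since `q̲² = -|q̲|²`, the radial term of `G` becomes minus the derivative along the real axis.
-/
theorem sliceCR_of_hasFDerivAt {g : Para m → Cl m} {q : Para m} {g' : Para m →L[ℝ] Cl m}
    (hq : 0 < vecNorm q) (hg : HasFDerivAt g g' q)
    (h : g' (vecPart q) = vec q * g' (EuclideanSpace.single 0 1)) : sliceCR g q = 0 := by
  have h1 : ∑ j : Fin m, q j.succ • lineDeriv ℝ g q (EuclideanSpace.single j.succ 1) =
      g' (vecPart q) := by
    rw [vecPart, map_sum]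
    refine Finset.sum_congr rfl fun j _ => ?_
    rw [map_smul, (hg.hasLineDerivAt _).lineDeriv]
  rw [sliceCR, h1, h, (hg.hasLineDerivAt _).lineDeriv, ← mul_assoc, smul_mul_assoc, vec_mul_self,
    smul_smul, mul_neg, inv_mul_cancel₀ (pow_ne_zero 2 hq.ne'), neg_smul, one_smul, neg_mul,
    one_mul, add_neg_cancel]

theorem sliceCR_teodorescu (hm : 1 ≤ m) {Ω : Set (Para m)} {R : ℝ}
    (hΩ : MeasurableSet Ω) (hR : ∀ x ∈ Ω, ‖x‖ < R) (hpos : ∀ x ∈ Ω, 0 < vecNorm x)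
    {p P : ℝ} (hpP : p.HolderConjugate P) (hPm : ((m : ℝ) - 1) * (P - 1) < 1)
    {f : Para m → Cl m} (hf : MemLp f (ENNReal.ofReal p) (volume.restrict Ω))
    {q : Para m} (hq : 0 < vecNorm q) {ε : ℝ} (hε : 0 < ε)
    (hd : ∀ q' ∈ Metric.closedBall q ε, ∀ x ∈ Ω, ε ^ 2 ≤ sliceDistSq q' x) :
    DifferentiableAt ℝ (teodorescu Ω f) q ∧ sliceCR (teodorescu Ω f) q = 0 := by
  obtain ⟨hint, hT⟩ := hasFDerivAt_teodorescu hm hΩ hR hpos hpP hPm hf hε hd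
  refine ⟨hT.differentiableAt, sliceCR_of_hasFDerivAt hq hT ?_⟩
  have hI : (∫ x in Ω, kernelKMulDeriv q x (f x)) (vecPart q) =
      vec q * (∫ x in Ω, kernelKMulDeriv q x (f x)) (EuclideanSpace.single 0 1) := by
    rw [ContinuousLinearMap.integral_apply hint, ContinuousLinearMap.integral_apply hint,
      ← mulL_apply, ← ContinuousLinearMap.integral_comp_comm _ (hint.apply_continuousLinearMap _)]
    refine setIntegral_congr_fun hΩ fun x hx => ?_
    have hne : kernelDen q x ≠ 0 := ((pow_pos hε 4).trans_le
      (pow_four_le_kernelDen hε (hd q (Metric.mem_closedBall_self hε.le) x hx))).ne'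
    simp [kernelKMulDeriv, kernelDeriv_vecPart hne, mul_assoc]
  simp only [neg_apply, smul_apply, hI, mul_neg,
    mul_smul_comm]

theorem exists_closedBall_le_sliceDistSq {D : Set ℂ} (hpos : ∀ x ∈ axialSet m D, 0 < vecNorm x)
    {q : Para m} (hq : 0 < vecNorm q) (hqc : q ∉ closure (axialSet m D)) :
    ∃ ε : ℝ, 0 < ε ∧ ∀ q' ∈ Metric.closedBall q ε, ∀ x ∈ axialSet m D,
      ε ^ 2 ≤ sliceDistSq q' x := by
  have hU : IsOpen ((closure (axialSet m D))ᶜ ∩ {q : Para m | 0 < vecNorm q}) :=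
    isClosed_closure.isOpen_compl.inter (isOpen_lt continuous_const continuous_vecNorm)
  obtain ⟨δ, hδ, hball⟩ := Metric.isOpen_iff.1 hU q ⟨hqc, hq⟩
  -- Half the radius: a point within `δ / 2` of `q'` is still in the `δ`-ball around `q`.
  refine ⟨δ / 2, by positivity, fun q' hq' x hx => ?_⟩
  rw [Metric.mem_closedBall] at hq'
  refine sq_le_sliceDistSq_of_pos hpos
    (hball (Metric.mem_ball.2 (by linarith))).2 (by positivity) (fun y hy => ?_) hx
  by_contra! hlt
  have hy' : y ∈ Metric.ball q δ := by
    rw [← dist_eq_norm, dist_comm] at hlt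
    exact Metric.mem_ball.2 (by linarith [dist_triangle y q' q])
  exact (hball hy').1 (subset_closure hy)

end SliceClifford

theorem mainTheorem3 (m : ℕ) (hm : 1 ≤ m)
    (Ω : Set (SliceClifford.Para m))
    (hΩ : SliceClifford.IsAxiallySymmetric Ω)
    (hΩb : Bornology.IsBounded Ω)
    (hΩr : Disjoint Ω (SliceClifford.realAxis m))
    (p : ℝ) (hp : max (m : ℝ) 2 < p) :
    (∀ f : SliceClifford.Para m → SliceClifford.Cl m,
      MemLp f (ENNReal.ofReal p) (volume.restrict Ω) →
        (∀ q : SliceClifford.Para m,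
          (q ∉ frontier Ω ∩ SliceClifford.realAxis m ∨ (m : ℝ) + 1 < p) →
            IntegrableOn (fun x => SliceClifford.kernelK q x * f x) Ω volume) ∧
        (∀ q : SliceClifford.Para m, q ∉ closure Ω → q ∉ SliceClifford.realAxis m →
          DifferentiableAt ℝ (SliceClifford.teodorescu Ω f) q ∧
            SliceClifford.sliceCR (SliceClifford.teodorescu Ω f) q = 0)) ∧
    (∃ C : ℝ≥0, ∀ f : SliceClifford.Para m → SliceClifford.Cl m,
      MemLp f (ENNReal.ofReal p) (volume.restrict Ω) →
        MemLp (SliceClifford.teodorescu Ω f) (ENNReal.ofReal p) (volume.restrict Ω) ∧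
        eLpNorm (SliceClifford.teodorescu Ω f) (ENNReal.ofReal p) (volume.restrict Ω) ≤
          C * eLpNorm f (ENNReal.ofReal p) (volume.restrict Ω)) := by
  open SliceClifford in
  obtain ⟨hpm, hp2⟩ := max_lt_iff.1 hp
  have hm' : (1 : ℝ) ≤ m := by exact_mod_cast hm
  have hpP : p.HolderConjugate p.conjExponent := Real.HolderConjugate.conjExponent (by linarith)
  set P := p.conjExponent
  have hpP1 : (p - 1) * (P - 1) = 1 := by linarith [hpP.mul_eq_add]
  have hP1 : 1 < P := hpP.symm.lt
  have hP2 : P < 2 := by nlinarith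
  have hPm : ((m : ℝ) - 1) * (P - 1) < 1 := by nlinarith
  have hΩm : MeasurableSet Ω := hΩ.1.measurableSet
  have hpos : ∀ x ∈ Ω, 0 < vecNorm x := fun x hx =>
    (vecNorm_pos_iff x).2 (Set.disjoint_left.1 hΩr hx)
  obtain ⟨R, hRΩ⟩ := hΩb.subset_ball 0
  have hR : ∀ x ∈ Ω, ‖x‖ < R := fun x hx => by simpa using hRΩ hx
  refine ⟨fun f hf => ⟨fun q hq => ?_, fun q hqc hqr => ?_⟩, ?_⟩
  · refine integrableOn_kernelK_mul hpP hf ?_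
    rcases hq with hq | hq
    · by_cases hqr : q ∈ realAxis m
      -- As `Ω` misses the axis, a real point of its closure is a boundary point.
      · have hqc : q ∉ closure Ω := fun hcl =>
          hq ⟨by rw [hΩ.1.frontier_eq]; exact ⟨hcl, fun h => Set.disjoint_left.1 hΩr h hqr⟩, hqr⟩
        obtain ⟨δ, hδ, hball⟩ := Metric.isOpen_iff.1 isClosed_closure.isOpen_compl q hqc
        refine kernelInt_lt_top_of_le hm hΩm hR hpos hP1 hPm hδ fun x hx => ?_
        rw [sliceDistSq_of_real hqr]
        refine pow_le_pow_left₀ hδ.le ?_ 2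
        by_contra! hlt
        refine hball (a := x) ?_ (subset_closure hx)
        rwa [Metric.mem_ball, dist_comm, dist_eq_norm]
      · exact kernelInt_lt_top_of_pos hm hΩm hR hpos hP1 hP2 hPm ((vecNorm_pos_iff q).2 hqr)
    -- Through `(p - 1)(P - 1) = 1`, the condition `p > m + 1` reads `m (P - 1) < 1`.
    · obtain ⟨C, hC, hK⟩ := exists_kernelInt_le_const hm hΩm hR hpos hP1
        (show (m : ℝ) * (P - 1) < 1 by nlinarith)
      exact (hK q).trans_lt hC.lt_top
  · obtain ⟨D, -, rfl⟩ := hΩ.2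
    have hq := (vecNorm_pos_iff q).2 hqr
    obtain ⟨ε, hε, hd⟩ := exists_closedBall_le_sliceDistSq hpos hq hqc
    exact sliceCR_teodorescu hm hΩm hR hpos hpP hPm hf hq hε hd
  · obtain ⟨C, hC⟩ := exists_eLpNorm_teodorescu_le hpP
      (lintegral_kernelInt_rpow_lt_top hm hΩm hR hpos hp2 hpm hpP1)
    refine ⟨C, fun f hf => ⟨⟨aestronglyMeasurable_teodorescu hf.1, (hC f hf).trans_lt ?_⟩, hC f hf⟩⟩
    exact ENNReal.mul_lt_top ENNReal.coe_lt_top hf.2
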